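/- Let $f:(\mathbb R^2,0)\to(\mathbb R^3,0)$ be the germ of a cuspidal edge in the Martins–Saji normal form $$f(u,v)=\Bigl(u,\ \tfrac{a_{20}}2u^2+\tfrac{a_{30}}6u^3+\tfrac{v^2}2+u^4h_1(u),\ \tfrac{b_{20}}2u^2+\tfrac{b_{30}}6u^3+\tfrac{b_{12}}2uv^2+\tfrac{b_{03}}6v^3+u^4h_2(u)+u^2v^2h_3(u)+uv^3h_4(u)+v^4h_5(u,v)\Bigr),$$ where $b_{20}\ge 0$, $b_{03}\ne0$ and $h_1,\dots,h_5$ are $C^\infty$ near the origin; the coefficient $b_{30}$ is the edge inflectional curvature. Let $\psi$ be the smooth vector field along $f$ with $f_v=v\psi$, let $\nu=f_u\times\psi/\|f_u\times\psi\|$, and put $\hat E=\langle f_u,f_u\rangle$, $\hat F=\langle f_u,\psi\rangle$, $\hat G=\langle\psi,\psi\rangle$, $\hat L=-\langle f_u,\nu_u\rangle$, $\hat M=-\langle\psi,\nu_u\rangle$, $\hat N=-\langle\psi,\nu_v\rangle$, $\hat A=\hat E\hat N-2v\hat F\hat M+v\hat G\hat L$ and $\hat B=\sqrt{\hat A^2-4v(\hat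 E\hat G-\hat F^2)(\hat L\hat N-v\hat M^2)}$. The principal curvature of $f$ is the function $$\hat\kappa=\frac{2(\hat L\hat N-v\hat M^2)}{\hat A+\hat B}\ \text{ if } \hat N(0)>0,\qquad \hat\kappa=\frac{2(\hat L\hat N-v\hat M^2)}{\hat A-\hat B}\ \text{ if } \hat N(0)<0,$$ which is $C^\infty$ near $0$; the corresponding principal direction is $\hat{\boldsymbol v}=(\hat N-v\hat\kappa\hat G)\,\partial_u+(-\hat M+\hat\kappa\hat F)\,\partial_v$, and $0$ is called a ridge point of $f$ if $(\hat{\boldsymbol v}\hat\kappa)(0)=0$. Suppose that $\hat\kappa(0)\neq0$ (equivalently $b_{20}\ne 0$), put $t_0=1/\hat\kappa(0)$, and let $$\varphi(u,v)=-\tfrac12\bigl(\|f(0)+t_0\nu(0)-f(u,v)\|^2-t_0^2\bigr).$$ Say that $\varphi$ has a $D_4$ singularity at $0$ if its germ is right equivalent to $u^3+uv^2$ or to $u^3-uv^2$, that is, if it becomes one of these after composition with a germ of a $C^\infty$ diffeomorphism $(\mathbb R^2,0)\to(\mathbb R^2,0)$. Then $\varphi$ has a $D_4$ singularity at $0$ if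 and only if $b_{30}\neq0$ and $0$ is not a ridge point of $f$. -/

import Mathlib

open scoped ContDiff Topology InnerProductSpace Matrix

noncomputable section

namespace CuspidalEdge

/-- Euclidean three-space. -/
abbrev E3 : Type := EuclideanSpace ℝ (Fin 3)

/-- The germ of `g` at `x` is of class `C^∞`: `g` is `C^∞` at every point of a neighbourhood of
`x`. (In Mathlib `ContDiffAt ℝ ∞ g x` alone is weaker: it asks for `C^m` near `x` for each finite
`m`, on a neighbourhood that may depend on `m`.) -/
def SmoothGerm {E F : Type*} [NormedAddCommGroup E] [NormedSpace ℝ E]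
    [NormedAddCommGroup F] [NormedSpace ℝ F] (g : E → F) (x : E) : Prop :=
  ∀ᶠ y in 𝓝 x, ContDiffAt ℝ ∞ g y

/-- The partial derivative with respect to the first coordinate `u`. -/
def du {F : Type*} [NormedAddCommGroup F] [NormedSpace ℝ F] (g : ℝ × ℝ → F) (p : ℝ × ℝ) : F :=
  fderiv ℝ g p (1, 0)

/-- The partial derivative with respect to the second coordinate `v`. -/
def dv {F : Type*} [NormedAddCommGroup F] [NormedSpace ℝ F] (g : ℝ × ℝ → F) (p : ℝ × ℝ) : F :=
  fderiv ℝ g p (0, 1)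

/-- The vector product of Euclidean three-space. -/
def cross (x y : E3) : E3 := WithLp.toLp 2 (WithLp.ofLp x ⨯₃ WithLp.ofLp y)

/-- The Martins–Saji normal form of a cuspidal edge. -/
def normalForm (a₂₀ a₃₀ b₂₀ b₃₀ b₁₂ b₀₃ : ℝ) (h₁ h₂ h₃ h₄ : ℝ → ℝ) (h₅ : ℝ × ℝ → ℝ) :
    ℝ × ℝ → E3 := fun (u, v) =>
  !₂[u,
     a₂₀ / 2 * u ^ 2 + a₃₀ / 6 * u ^ 3 + v ^ 2 / 2 + u ^ 4 * h₁ u,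
     b₂₀ / 2 * u ^ 2 + b₃₀ / 6 * u ^ 3 + b₁₂ / 2 * (u * v ^ 2) + b₀₃ / 6 * v ^ 3
       + u ^ 4 * h₂ u + u ^ 2 * v ^ 2 * h₃ u + u * v ^ 3 * h₄ u + v ^ 4 * h₅ (u, v)]

/-! In what follows `f` is a map on the `(u, v)`-plane for which `(u, v)` are adapted coordinates
at the origin: the `u`-axis is the set of singular points near the origin, and `∂/∂v` spans the
kernel of `df` there. -/

/-- The vector field `ψ` along `f` with `f_v = v ψ`: it is `f_v / v` off the `u`-axis, and
`f_vv` on the `u`-axis. -/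
def psi (f : ℝ × ℝ → E3) (p : ℝ × ℝ) : E3 :=
  if p.2 = 0 then dv (dv f) p else p.2⁻¹ • dv f p

/-- The unit normal vector field `ν = (f_u × ψ) / ‖f_u × ψ‖`. -/
def normal (f : ℝ × ℝ → E3) (p : ℝ × ℝ) : E3 :=
  ‖cross (du f p) (psi f p)‖⁻¹ • cross (du f p) (psi f p)

/-- `Ê = ⟨f_u, f_u⟩`. -/
def coeffE (f : ℝ × ℝ → E3) (p : ℝ × ℝ) : ℝ := ⟪du f p, du f p⟫_ℝ

/-- `F̂ = ⟨f_u, ψ⟩`. -/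
def coeffF (f : ℝ × ℝ → E3) (p : ℝ × ℝ) : ℝ := ⟪du f p, psi f p⟫_ℝ

/-- `Ĝ = ⟨ψ, ψ⟩`. -/
def coeffG (f : ℝ × ℝ → E3) (p : ℝ × ℝ) : ℝ := ⟪psi f p, psi f p⟫_ℝ

/-- `L̂ = -⟨f_u, ν_u⟩`. -/
def coeffL (f : ℝ × ℝ → E3) (p : ℝ × ℝ) : ℝ := -⟪du f p, du (normal f) p⟫_ℝ

/-- `M̂ = -⟨ψ, ν_u⟩`. -/
def coeffM (f : ℝ × ℝ → E3) (p : ℝ × ℝ) : ℝ := -⟪psi f p, du (normal f) p⟫_ℝ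

/-- `N̂ = -⟨ψ, ν_v⟩`. -/
def coeffN (f : ℝ × ℝ → E3) (p : ℝ × ℝ) : ℝ := -⟪psi f p, dv (normal f) p⟫_ℝ

/-- `Â = Ê N̂ - 2 v F̂ M̂ + v Ĝ L̂`. -/
def coeffA (f : ℝ × ℝ → E3) (p : ℝ × ℝ) : ℝ :=
  coeffE f p * coeffN f p - 2 * p.2 * coeffF f p * coeffM f p + p.2 * coeffG f p * coeffL f p

/-- The radicand `Â² - 4 v (Ê Ĝ - F̂²) (L̂ N̂ - v M̂²)`. -/
def radicand (f : ℝ × ℝ → E3) (p : ℝ × ℝ) : ℝ :=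
  coeffA f p ^ 2 - 4 * p.2 * (coeffE f p * coeffG f p - coeffF f p ^ 2) *
    (coeffL f p * coeffN f p - p.2 * coeffM f p ^ 2)

/-- `B̂`, the square root of the radicand. -/
def coeffB (f : ℝ × ℝ → E3) (p : ℝ × ℝ) : ℝ := √(radicand f p)

/-- The function `κ̂₁`, in the form that makes sense on the `u`-axis when `N̂ < 0` there. Off the
`u`-axis it is `(Â + B̂) / (2 v (Ê Ĝ - F̂²))`, see `kappa₁_eq`. -/
def kappa₁ (f : ℝ × ℝ → E3) (p : ℝ × ℝ) : ℝ :=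
  2 * (coeffL f p * coeffN f p - p.2 * coeffM f p ^ 2) / (coeffA f p - coeffB f p)

/-- The function `κ̂₂`, in the form that makes sense on the `u`-axis when `N̂ > 0` there. Off the
`u`-axis it is `(Â - B̂) / (2 v (Ê Ĝ - F̂²))`, see `kappa₂_eq`. -/
def kappa₂ (f : ℝ × ℝ → E3) (p : ℝ × ℝ) : ℝ :=
  2 * (coeffL f p * coeffN f p - p.2 * coeffM f p ^ 2) / (coeffA f p + coeffB f p)

theorem kappa₁_eq (f : ℝ × ℝ → E3) (p : ℝ × ℝ) (hv : p.2 ≠ 0)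
    (hW : coeffE f p * coeffG f p - coeffF f p ^ 2 ≠ 0) (hr : 0 ≤ radicand f p)
    (hd : coeffA f p - coeffB f p ≠ 0) :
    kappa₁ f p = (coeffA f p + coeffB f p) /
      (2 * p.2 * (coeffE f p * coeffG f p - coeffF f p ^ 2)) := by
  have hB : coeffB f p ^ 2 = radicand f p := Real.sq_sqrt hr
  rw [kappa₁, div_eq_div_iff hd (mul_ne_zero (mul_ne_zero two_ne_zero hv) hW)]
  rw [radicand] at hB
  linear_combination hB

theorem kappa₂_eq (f : ℝ × ℝ → E3) (p : ℝ × ℝ) (hv : p.2 ≠ 0)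
    (hW : coeffE f p * coeffG f p - coeffF f p ^ 2 ≠ 0) (hr : 0 ≤ radicand f p)
    (hd : coeffA f p + coeffB f p ≠ 0) :
    kappa₂ f p = (coeffA f p - coeffB f p) /
      (2 * p.2 * (coeffE f p * coeffG f p - coeffF f p ^ 2)) := by
  have hB : coeffB f p ^ 2 = radicand f p := Real.sq_sqrt hr
  rw [kappa₂, div_eq_div_iff hd (mul_ne_zero (mul_ne_zero two_ne_zero hv) hW)]
  rw [radicand] at hB
  linear_combination hB

/-- The principal curvature `κ̂` of the cuspidal edge `f` near the origin: the one of `κ̂₁`, `κ̂₂`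
that extends smoothly across the `u`-axis, namely `κ̂₂` if `N̂ > 0` at the origin, and `κ̂₁` if
`N̂ < 0` there. -/
def principalCurvature (f : ℝ × ℝ → E3) : ℝ × ℝ → ℝ :=
  if 0 < coeffN f 0 then kappa₂ f else kappa₁ f

/-- The principal direction `(N̂ - v κ̂ Ĝ, -M̂ + κ̂ F̂)` that corresponds to `κ̂`. -/
def principalDirection (f : ℝ × ℝ → E3) (p : ℝ × ℝ) : ℝ × ℝ :=
  (coeffN f p - p.2 * principalCurvature f p * coeffG f p,
    -coeffM f p + principalCurvature f p * coeffF f p)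

/-- The origin is a ridge point of `f`: the derivative of the principal curvature along the
corresponding principal direction vanishes there. -/
def IsRidgePoint (f : ℝ × ℝ → E3) : Prop :=
  fderiv ℝ (principalCurvature f) 0 (principalDirection f 0) = 0

/-- The radius `t₀ = 1 / κ̂(0)`. -/
def focalRadius (f : ℝ × ℝ → E3) : ℝ := 1 / principalCurvature f 0

/-- The focal point `f(0) + t₀ ν(0)`. -/
def focalPoint (f : ℝ × ℝ → E3) : E3 := f 0 + focalRadius f • normal f 0

/-- The distance squared function
`φ(u, v) = -(1/2) (‖f(0) + t₀ ν(0) - f(u, v)‖² - t₀²)`. -/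
def distanceSquared (f : ℝ × ℝ → E3) (p : ℝ × ℝ) : ℝ :=
  -(1 / 2) * (‖focalPoint f - f p‖ ^ 2 - focalRadius f ^ 2)

/-- Right equivalence of the function germs of `k` and `h` at the origin of the plane: `k = h ∘ θ`
near the origin for a `C^∞` diffeomorphism germ `θ` that fixes the origin. -/
def RightEquivalent (k h : ℝ × ℝ → ℝ) : Prop :=
  ∃ θ : OpenPartialHomeomorph (ℝ × ℝ) (ℝ × ℝ),
    (0 : ℝ × ℝ) ∈ θ.source ∧ θ 0 = 0 ∧
    ContDiffOn ℝ ∞ θ θ.source ∧ ContDiffOn ℝ ∞ θ.symm θ.target ∧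
    ∀ᶠ p in 𝓝 (0 : ℝ × ℝ), k p = h (θ p)

/-- `k` has a `D₄` singularity at the origin: its germ is right equivalent to `u³ + u v²` or to
`u³ - u v²`. -/
def HasD4Singularity (k : ℝ × ℝ → ℝ) : Prop :=
  RightEquivalent k (fun p => p.1 ^ 3 + p.1 * p.2 ^ 2) ∨
    RightEquivalent k (fun p => p.1 ^ 3 - p.1 * p.2 ^ 2)

end CuspidalEdge

end

open CuspidalEdge

noncomputable section

namespace CuspidalEdge

/-! Write the normal form as `(u, u² s + v²/2, u² (β + u τ) + v² (u γ + v δ))`, with `β = b₂₀/2`,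
`τ(0) = b₃₀/6`, `γ(0) = b₁₂/2`, `δ(0) = b₀₃/6`. At the origin the normal is the third basis vector
and the principal curvature is `2β`, so with `x`, `y` the last two coordinates, `φ = t₀ y - (u² + x²
+ y²)/2` where `2 t₀ β = 1`. The quadratic part therefore cancels; since `x²` and `y²` have order
four, the cubic part is `t₀ (τ u³ + γ u v² + δ v³)`, taken at `0`. Its discriminant is `-t₀⁴ τ (27 τ
δ² + 4 γ³)`.

A germ without terms of order below three is `D₄` exactly when its cubic part has nonzero
discriminant (`hasD4Singularity_iff`). One direction factors off a smooth root line and completes a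
square, which gives an exact normal form without any determinacy theorem; the other compares cubic
parts under the linear part of the diffeomorphism.

It remains to recognise the second factor: differentiating the principal curvature along its
direction gives a nonzero multiple of `27 τ δ² + 4 γ³` (`isRidgePoint_iff`,
`cuspidalEdge_invariants`). So the discriminant is nonzero iff `b₃₀ ≠ 0` and the origin is not a
ridge point. -/

/-! ### Recognition of `D₄` singularities by the discriminant of the cubic part. -/

/-- The discriminant of the binary cubic form `a u³ + b u² v + c u v² + d v³`. -/
def cubicDisc (a b c d : ℝ) : ℝ :=
  b ^ 2 * c ^ 2 - 4 * a * c ^ 3 - 4 * b ^ 3 * d - 27 * a ^ 2 * d ^ 2 + 18 * a * b * c * d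

/-- A root `t` is the slope of a line `v = t u` on which the cubic form vanishes. Multiplying by `d`
makes the leading coefficient positive, so the intermediate value theorem needs no case split. -/
theorem exists_cubic_root {a b c d : ℝ} (hd : d ≠ 0) :
    ∃ t : ℝ, a + t * b + t ^ 2 * c + t ^ 3 * d = 0 := by
  have hd' : 0 < |d| := abs_pos.2 hd
  set S := |a| + |b| + |c| with hS
  have hS0 : 0 ≤ S := by positivity
  -- Cauchy-type bound: `|d| M = |d| + S` exceeds `S`, so the leading term dominates at `±M`.
  set M := 1 + S / |d| with hM
  have hM1 : 1 ≤ M := by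
    have : 0 ≤ S / |d| := by positivity
    linarith
  have hMd : |d| * M = |d| + S := by rw [hM]; field_simp
  have key : |d| * (|a| + |b| * M + |c| * M ^ 2) < d ^ 2 * M ^ 3 := by
    have h1 : |a| + |b| * M + |c| * M ^ 2 ≤ S * M ^ 2 := by
      have h2 : |a| * 1 ≤ |a| * M ^ 2 :=
        mul_le_mul_of_nonneg_left (one_le_pow₀ hM1) (abs_nonneg a)
      have h3 : |b| * M ≤ |b| * M ^ 2 :=
        mul_le_mul_of_nonneg_left (by nlinarith) (abs_nonneg b)
      rw [hS]; linarith
    have h4 : d ^ 2 * M ^ 3 = |d| * ((|d| + S) * M ^ 2) := by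
      rw [← hMd, ← sq_abs d]; ring
    rw [h4]
    have : 0 < |d| * M ^ 2 := by positivity
    exact mul_lt_mul_of_pos_left (by linarith) hd'
  have hM0 : 0 ≤ M := by linarith
  have bound : ∀ x : ℝ, |x| = M → |d * (a + x * b + x ^ 2 * c)| < d ^ 2 * M ^ 3 := by
    intro x hx
    refine lt_of_le_of_lt ?_ key
    rw [abs_mul]
    refine mul_le_mul_of_nonneg_left ?_ (abs_nonneg d)
    refine (abs_add_three _ _ _).trans ?_
    rw [abs_mul, abs_mul, abs_pow, hx]
    linarith
  have hpos := abs_lt.1 (bound M (abs_of_nonneg hM0))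
  have hneg := abs_lt.1 (bound (-M) (by rw [abs_neg, abs_of_nonneg hM0]))
  have hcont : Continuous fun t : ℝ => d * (a + t * b + t ^ 2 * c + t ^ 3 * d) := by fun_prop
  obtain ⟨t, -, ht⟩ := intermediate_value_Icc (a := -M) (b := M) (by linarith) hcont.continuousOn
    (show (0 : ℝ) ∈ _ from ⟨by nlinarith [hneg.2], by nlinarith [hpos.1]⟩)
  exact ⟨t, (mul_eq_zero.1 ht).resolve_left hd⟩

/-- A simple root of a cubic polynomial depends analytically on the coefficients. -/
theorem exists_analytic_cubic_root {a b c d t : ℝ} (ht : a + t * b + t ^ 2 * c + t ^ 3 * d = 0)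
    (ht' : b + 2 * t * c + 3 * t ^ 2 * d ≠ 0) :
    ∃ r : ℝ × ℝ × ℝ × ℝ → ℝ, ContDiffAt ℝ ω r (a, b, c, d) ∧ r (a, b, c, d) = t ∧
      ∀ᶠ q in 𝓝 (a, b, c, d),
        q.1 + r q * q.2.1 + r q ^ 2 * q.2.2.1 + r q ^ 3 * q.2.2.2 = 0 := by
  let G : (ℝ × ℝ × ℝ × ℝ) × ℝ → ℝ := fun z =>
    z.1.1 + z.2 * z.1.2.1 + z.2 ^ 2 * z.1.2.2.1 + z.2 ^ 3 * z.1.2.2.2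
  have hG : ContDiffAt ℝ ω G ((a, b, c, d), t) := by
    apply ContDiff.contDiffAt; unfold G; fun_prop
  have hline : HasDerivAt (fun s : ℝ => G ((a, b, c, d), s))
      (b + 2 * t * c + 3 * t ^ 2 * d) t := by
    have h1 := ((((hasDerivAt_id t).mul_const b).const_add a).add
      (((hasDerivAt_id t).pow 2).mul_const c)).add (((hasDerivAt_id t).pow 3).mul_const d)
    convert! h1 using 1
    simp
  have hinr : (fderiv ℝ G ((a, b, c, d), t) ∘L .inr ℝ (ℝ × ℝ × ℝ × ℝ) ℝ) =
      (ContinuousLinearEquiv.unitsEquivAut ℝ (Units.mk0 _ ht') : ℝ →L[ℝ] ℝ) := by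
    have h2 := (hG.differentiableAt (by simp)).hasFDerivAt.comp t
      (hasFDerivAt_prodMk_right (𝕜 := ℝ) (a, b, c, d) t)
    have h3 := h2.unique hline.hasFDerivAt
    rw [h3]
    ext; simp
  have hinv : (fderiv ℝ G ((a, b, c, d), t) ∘L .inr ℝ (ℝ × ℝ × ℝ × ℝ) ℝ).IsInvertible :=
    ⟨_, hinr.symm⟩
  refine ⟨hG.implicitFunction (by simp) hinv, hG.contDiffAt_implicitFunction (by simp) hinv,
    hG.implicitFunction_apply_self (by simp) hinv, ?_⟩
  filter_upwards [hG.eventually_apply_implicitFunction (by simp) hinv] with q hq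
  exact hq.trans ht

theorem SmoothGerm.contDiffAt {E F : Type*} [NormedAddCommGroup E] [NormedSpace ℝ E]
    [NormedAddCommGroup F] [NormedSpace ℝ F] {g : E → F} {x : E} (h : SmoothGerm g x) :
    ContDiffAt ℝ ∞ g x := h.self_of_nhds

theorem SmoothGerm.comp {E F G : Type*} [NormedAddCommGroup E] [NormedSpace ℝ E]
    [NormedAddCommGroup F] [NormedSpace ℝ F] [NormedAddCommGroup G] [NormedSpace ℝ G]
    {g : F → G} {h : E → F} {x : E} (hg : SmoothGerm g (h x)) (hh : SmoothGerm h x) :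
    SmoothGerm (fun p => g (h p)) x := by
  filter_upwards [hh, hh.contDiffAt.continuousAt.eventually hg] with p h1 h2
  exact ContDiffAt.comp p h2 h1

/-- A smooth map germ of the plane with invertible derivative is a diffeomorphism germ. -/
theorem exists_diffeo_germ {Φ : ℝ × ℝ → ℝ × ℝ} {e : (ℝ × ℝ) ≃L[ℝ] (ℝ × ℝ)}
    (hΦ : SmoothGerm Φ 0) (hd : HasFDerivAt Φ (e : ℝ × ℝ →L[ℝ] ℝ × ℝ) 0) :
    ∃ θ : OpenPartialHomeomorph (ℝ × ℝ) (ℝ × ℝ), (0 : ℝ × ℝ) ∈ θ.source ∧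
      ContDiffOn ℝ ∞ θ θ.source ∧ ContDiffOn ℝ ∞ θ.symm θ.target ∧ ∀ p, θ p = Φ p := by
  have hs := hΦ.contDiffAt
  let θ₀ := hs.toOpenPartialHomeomorph Φ hd (by simp)
  have hcont : ContinuousAt (fderiv ℝ Φ) 0 :=
    (hs.fderiv_right (m := 0) (by simp)).continuousAt
  have hinv : ∀ᶠ p in 𝓝 (0 : ℝ × ℝ), fderiv ℝ Φ p ∈
      Set.range ((↑) : ((ℝ × ℝ) ≃L[ℝ] (ℝ × ℝ)) → ℝ × ℝ →L[ℝ] ℝ × ℝ) :=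
    hcont.eventually (ContinuousLinearEquiv.isOpen.mem_nhds ⟨e, hd.fderiv.symm⟩)
  -- Shrinking to where `Φ` is smooth with invertible derivative makes the inverse smooth on the
  -- whole target, not only at the image of `0`.
  obtain ⟨U, hU, hUo, h0U⟩ := eventually_nhds_iff.1 (hΦ.and hinv)
  refine ⟨θ₀.restrOpen U hUo, ⟨hs.mem_toOpenPartialHomeomorph_source hd (by simp), h0U⟩,
    ?_, ?_, fun p => rfl⟩
  · intro p hp
    exact (hU p hp.2).1.contDiffWithinAt
  · intro q hq
    have hp := (θ₀.restrOpen U hUo).map_target hq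
    obtain ⟨h1, e', he'⟩ := hU _ hp.2
    refine (OpenPartialHomeomorph.contDiffAt_symm (f₀' := e') _ hq ?_ h1).contDiffWithinAt
    rw [he']
    exact (h1.differentiableAt (by simp)).hasFDerivAt

/-- The factor `g` enters only through its value, so derivatives of auxiliary coefficients never
have to be computed. -/
theorem HasFDerivAt.mul_of_eq_zero {E : Type*} [NormedAddCommGroup E] [NormedSpace ℝ E]
    {g x : E → ℝ} {x' : E →L[ℝ] ℝ} {p : E} (hg : DifferentiableAt ℝ g p)
    (hx : HasFDerivAt x x' p) (h0 : x p = 0) :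
    HasFDerivAt (fun q => g q * x q) (g p • x') p := by
  have := hg.hasFDerivAt.mul hx
  rwa [h0, zero_smul, add_zero] at this

theorem exists_equiv_shear {m γ : ℝ} (hm : m ≠ 0) (hγ : γ ≠ 0) (β t : ℝ) :
    ∃ e : (ℝ × ℝ) ≃L[ℝ] (ℝ × ℝ), (e : ℝ × ℝ →L[ℝ] ℝ × ℝ) =
      (m • (ContinuousLinearMap.snd ℝ ℝ ℝ - t • ContinuousLinearMap.fst ℝ ℝ ℝ)).prod
        (γ • (ContinuousLinearMap.fst ℝ ℝ ℝ +
          β • (ContinuousLinearMap.snd ℝ ℝ ℝ - t • ContinuousLinearMap.fst ℝ ℝ ℝ))) := by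
  let u : ℝ × ℝ →L[ℝ] ℝ := γ⁻¹ • ContinuousLinearMap.snd ℝ ℝ ℝ
    - (β * m⁻¹) • ContinuousLinearMap.fst ℝ ℝ ℝ
  refine ⟨ContinuousLinearEquiv.equivOfInverse
    ((m • (ContinuousLinearMap.snd ℝ ℝ ℝ - t • ContinuousLinearMap.fst ℝ ℝ ℝ)).prod
      (γ • (ContinuousLinearMap.fst ℝ ℝ ℝ +
        β • (ContinuousLinearMap.snd ℝ ℝ ℝ - t • ContinuousLinearMap.fst ℝ ℝ ℝ))))
    (u.prod (m⁻¹ • ContinuousLinearMap.fst ℝ ℝ ℝ + t • u)) ?_ ?_, rfl⟩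
  · rintro ⟨y, z⟩
    simp [u]
    constructor <;> (field_simp; ring)
  · rintro ⟨y, z⟩
    simp [u]
    constructor <;> (field_simp; try ring)

theorem exists_sign {x : ℝ} (hx : x ≠ 0) : ∃ s : ℝ, s ^ 2 = 1 ∧ 0 < s * x := by
  rcases lt_or_gt_of_ne hx with h | h
  · exact ⟨-1, by norm_num, by linarith⟩
  · exact ⟨1, by norm_num, by linarith⟩

theorem hasD4Singularity_of_normal {k : ℝ × ℝ → ℝ} {Φ : ℝ × ℝ → ℝ × ℝ}
    {e : (ℝ × ℝ) ≃L[ℝ] (ℝ × ℝ)} {ε : ℝ} (hε : ε ^ 2 = 1) (hΦ : SmoothGerm Φ 0) (h0 : Φ 0 = 0)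
    (hd : HasFDerivAt Φ (e : ℝ × ℝ →L[ℝ] ℝ × ℝ) 0)
    (hk : ∀ᶠ p in 𝓝 (0 : ℝ × ℝ), k p = (Φ p).1 ^ 3 + ε * ((Φ p).1 * (Φ p).2 ^ 2)) :
    HasD4Singularity k := by
  obtain ⟨θ, h0s, h1, h2, h3⟩ := exists_diffeo_germ hΦ hd
  rcases (sq_eq_sq_iff_eq_or_eq_neg.1 (hε.trans (one_pow 2).symm)) with rfl | rfl
  · refine Or.inl ⟨θ, h0s, (h3 0).trans h0, h1, h2, ?_⟩
    filter_upwards [hk] with p hp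
    rw [hp, h3]; ring
  · refine Or.inr ⟨θ, h0s, (h3 0).trans h0, h1, h2, ?_⟩
    filter_upwards [hk] with p hp
    rw [hp, h3]; ring

/-- A function germ whose `3`-jet is a nondegenerate cubic form has a `D₄` singularity. -/
theorem hasD4Singularity_of_cubicDisc_ne_zero {k A B C D : ℝ × ℝ → ℝ}
    (hA : SmoothGerm A 0) (hB : SmoothGerm B 0) (hC : SmoothGerm C 0) (hD : SmoothGerm D 0)
    (hk : ∀ᶠ p in 𝓝 (0 : ℝ × ℝ), k p =
      p.1 ^ 3 * A p + p.1 ^ 2 * p.2 * B p + p.1 * p.2 ^ 2 * C p + p.2 ^ 3 * D p)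
    (hD0 : D 0 ≠ 0) (hdisc : cubicDisc (A 0) (B 0) (C 0) (D 0) ≠ 0) :
    HasD4Singularity k := by
  obtain ⟨t, ht⟩ := exists_cubic_root (a := A 0) (b := B 0) (c := C 0) hD0
  -- Substituting `v = x + t u` leaves `x (P u² + Q u x + D x²)`. The discriminant is `P²`, which
  -- detects a multiple root, times the discriminant of the quadratic factor.
  have hfac : cubicDisc (A 0) (B 0) (C 0) (D 0) =
      (B 0 + 2 * t * C 0 + 3 * t ^ 2 * D 0) ^ 2 * ((C 0 + 3 * t * D 0) ^ 2
        - 4 * (B 0 + 2 * t * C 0 + 3 * t ^ 2 * D 0) * D 0) := by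
    rw [cubicDisc, show A 0 = -(t * B 0 + t ^ 2 * C 0 + t ^ 3 * D 0) by linarith]
    ring
  have hP0 : B 0 + 2 * t * C 0 + 3 * t ^ 2 * D 0 ≠ 0 := by
    intro h; apply hdisc; rw [hfac, h]; ring
  have hQ0 : (C 0 + 3 * t * D 0) ^ 2 - 4 * (B 0 + 2 * t * C 0 + 3 * t ^ 2 * D 0) * D 0 ≠ 0 := by
    intro h; apply hdisc; rw [hfac, h]; ring
  obtain ⟨r, hr, hrt, hroot⟩ := exists_analytic_cubic_root ht hP0
  have hco : SmoothGerm (fun p => (A p, B p, C p, D p)) 0 := by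
    filter_upwards [hA, hB, hC, hD] with p h1 h2 h3 h4
    exact h1.prodMk (h2.prodMk (h3.prodMk h4))
  -- Analyticity at a point spreads to a neighbourhood, which `C^∞` at a point would not give.
  have hrs : SmoothGerm r (A 0, B 0, C 0, D 0) := by
    filter_upwards [hr.eventually (by simp)] with q hq
    exact hq.of_le (by simp)
  obtain ⟨T, hT, hT0, hTroot⟩ : ∃ T : ℝ × ℝ → ℝ, SmoothGerm T 0 ∧ T 0 = t ∧
      ∀ᶠ p in 𝓝 0, A p + T p * B p + T p ^ 2 * C p + T p ^ 3 * D p = 0 :=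
    ⟨_, SmoothGerm.comp (h := fun p => (A p, B p, C p, D p)) hrs hco, hrt, hco.contDiffAt.continuousAt.eventually hroot⟩
  -- With the root `T` now a function and `x = v - T u`, the identity `k = x (P u² + Q u x + D x²)`
  -- holds exactly near the origin. Completing the square turns it into `K x³ + P x (u + β x)²`,
  -- where `β = Q / (2P)`.
  let P : ℝ × ℝ → ℝ := fun p => B p + 2 * T p * C p + 3 * T p ^ 2 * D p
  let Q : ℝ × ℝ → ℝ := fun p => C p + 3 * T p * D p
  let K : ℝ × ℝ → ℝ := fun p => D p - Q p ^ 2 / (4 * P p)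
  have hP : SmoothGerm P 0 := by
    filter_upwards [hB, hC, hD, hT] with p h1 h2 h3 h4
    exact (h1.add ((contDiffAt_const.mul h4).mul h2)).add
      ((contDiffAt_const.mul (h4.pow 2)).mul h3)
  have hQ : SmoothGerm Q 0 := by
    filter_upwards [hC, hD, hT] with p h2 h3 h4
    exact h2.add ((contDiffAt_const.mul h4).mul h3)
  have hP0' : P 0 ≠ 0 := by simpa [P, hT0] using hP0
  have hPne : ∀ᶠ p in 𝓝 0, P p ≠ 0 := hP.contDiffAt.continuousAt.eventually_ne hP0'
  have hK : SmoothGerm K 0 := by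
    filter_upwards [hD, hP, hQ, hPne] with p h1 h2 h3 h4
    exact h1.sub ((h3.pow 2).div (contDiffAt_const.mul h2) (by simpa using h4))
  have hK0 : K 0 ≠ 0 := by
    intro h
    apply hQ0
    have h' : D 0 - Q 0 ^ 2 / (4 * P 0) = 0 := h
    have h2 : Q 0 ^ 2 = 4 * P 0 * D 0 := by field_simp at h'; linarith
    have h3 : (C 0 + 3 * t * D 0) ^ 2 = 4 * (B 0 + 2 * t * C 0 + 3 * t ^ 2 * D 0) * D 0 := by
      simpa [P, Q, hT0] using h2
    linarith
  -- The signs keep the arguments of the real cube and square roots positive: `σ` is the sign of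
  -- `K`, and `ε`, the sign of `σ P`, selects the form of `D₄`.
  obtain ⟨σ, hσ, hσK⟩ := exists_sign hK0
  have hσ0 : σ ≠ 0 := by rintro rfl; norm_num at hσ
  obtain ⟨ε, hε, hεP⟩ := exists_sign (mul_ne_zero hσ0 hP0')
  let α : ℝ × ℝ → ℝ := fun p => (σ * K p) ^ (1 / 3 : ℝ)
  let γ : ℝ × ℝ → ℝ := fun p => √(ε * (σ * P p) / α p)
  have hKpos : ∀ᶠ p in 𝓝 0, 0 < σ * K p :=
    (continuousAt_const.mul hK.contDiffAt.continuousAt).eventually_const_lt hσK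
  have hPpos : ∀ᶠ p in 𝓝 0, 0 < ε * (σ * P p) :=
    (continuousAt_const.mul (continuousAt_const.mul
      hP.contDiffAt.continuousAt)).eventually_const_lt hεP
  have hα : SmoothGerm α 0 := by
    filter_upwards [hK, hKpos] with p h1 h2
    exact (contDiffAt_const.mul h1).rpow_const_of_ne h2.ne'
  have hγ : SmoothGerm γ 0 := by
    filter_upwards [hP, hα, hPpos, hKpos] with p h1 h2 h3 h4
    have : 0 < α p := Real.rpow_pos_of_pos h4 _
    exact ((contDiffAt_const.mul (contDiffAt_const.mul h1)).div h2 this.ne').sqrt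
      (div_pos h3 this).ne'
  have hα0 : 0 < α 0 := Real.rpow_pos_of_pos hσK _
  have hγ0 : 0 < γ 0 := Real.sqrt_pos.2 (div_pos hεP hα0)
  let x : ℝ × ℝ → ℝ := fun p => p.2 - T p * p.1
  let β : ℝ × ℝ → ℝ := fun p => Q p / (2 * P p)
  have hx : SmoothGerm x 0 := by
    filter_upwards [hT] with p h1
    exact contDiffAt_snd.sub (h1.mul contDiffAt_fst)
  have hβ : SmoothGerm β 0 := by
    filter_upwards [hP, hQ, hPne] with p h2 h3 h4
    exact h3.div (contDiffAt_const.mul h2) (by simpa using h4)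
  let Φ : ℝ × ℝ → ℝ × ℝ := fun p => ((σ * α p) * x p, γ p * (p.1 + β p * x p))
  have hx0 : x 0 = 0 := by simp [x]
  have hΦ0 : Φ 0 = 0 := by simp [Φ, hx0]
  have hΦ : SmoothGerm Φ 0 := by
    filter_upwards [hα, hγ, hx, hβ] with p h1 h2 h3 h4
    exact ((contDiffAt_const.mul h1).mul h3).prodMk (h2.mul (contDiffAt_fst.add (h4.mul h3)))
  have hdx : HasFDerivAt x
      (ContinuousLinearMap.snd ℝ ℝ ℝ - t • ContinuousLinearMap.fst ℝ ℝ ℝ) 0 := by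
    have := (hasFDerivAt_snd (𝕜 := ℝ) (p := (0 : ℝ × ℝ))).sub
      (HasFDerivAt.mul_of_eq_zero (hT.contDiffAt.differentiableAt (by simp))
        (hasFDerivAt_fst (𝕜 := ℝ) (p := (0 : ℝ × ℝ))) rfl)
    rwa [hT0] at this
  have hdX := HasFDerivAt.mul_of_eq_zero (g := fun p => σ * α p)
    ((hα.contDiffAt.differentiableAt (by simp)).const_mul σ) hdx hx0
  have hdY := HasFDerivAt.mul_of_eq_zero (hγ.contDiffAt.differentiableAt (by simp))
    ((hasFDerivAt_fst (𝕜 := ℝ) (p := (0 : ℝ × ℝ))).add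
      (HasFDerivAt.mul_of_eq_zero (hβ.contDiffAt.differentiableAt (by simp)) hdx hx0))
    (by simp [hx0])
  obtain ⟨e, he⟩ := exists_equiv_shear (mul_ne_zero hσ0 hα0.ne') hγ0.ne' (β 0) t
  have hd : HasFDerivAt Φ (e : ℝ × ℝ →L[ℝ] ℝ × ℝ) 0 := by
    rw [he]
    exact hdX.prodMk hdY
  refine hasD4Singularity_of_normal hε hΦ hΦ0 hd ?_
  filter_upwards [hk, hTroot, hPne, hKpos, hPpos] with p h1 h2 h3 h4 h5
  have hαp : 0 < α p := Real.rpow_pos_of_pos h4 _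
  have hα3 : α p ^ 3 = σ * K p := by
    rw [← Real.rpow_natCast, ← Real.rpow_mul h4.le]; norm_num
  have hγ2 : γ p ^ 2 = ε * (σ * P p) / α p := Real.sq_sqrt (div_pos h5 hαp).le
  have hX3 : (Φ p).1 ^ 3 = K p * x p ^ 3 := by
    calc (σ * α p * x p) ^ 3 = σ ^ 2 * σ * α p ^ 3 * x p ^ 3 := by ring
      _ = σ ^ 2 * (σ ^ 2 * (K p * x p ^ 3)) := by rw [hα3]; ring
      _ = K p * x p ^ 3 := by rw [hσ]; ring
  have hXY : ε * ((Φ p).1 * (Φ p).2 ^ 2) = x p * P p * (p.1 + β p * x p) ^ 2 := by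
    calc ε * ((σ * α p * x p) * (γ p * (p.1 + β p * x p)) ^ 2)
        = ε * (σ * α p * x p) * γ p ^ 2 * (p.1 + β p * x p) ^ 2 := by ring
      _ = ε ^ 2 * σ ^ 2 * (x p * P p * (p.1 + β p * x p) ^ 2) := by
          rw [hγ2]; field_simp
      _ = _ := by rw [hε, hσ]; ring
  rw [hX3, hXY, h1]
  have hA' : A p = -(T p * B p + T p ^ 2 * C p + T p ^ 3 * D p) := by linarith
  have hxq : K p * x p ^ 3 + x p * P p * (p.1 + β p * x p) ^ 2 =
      x p * (p.1 ^ 2 * P p + p.1 * x p * Q p + x p ^ 2 * D p) := by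
    simp only [K, β]; field_simp; ring
  rw [hxq, hA']
  simp only [x, P, Q]
  ring

/-- The arguments are the coefficients of `X³ + ε X Y²` with `X = α u + β v`, `Y = γ u + δ v`. The
discriminant is an invariant of weight six, and it equals `-4 ε³` for the identity substitution. -/
theorem cubicDisc_linear_substitution (α β γ δ ε : ℝ) :
    cubicDisc (α ^ 3 + ε * (α * γ ^ 2)) (3 * α ^ 2 * β + ε * (β * γ ^ 2 + 2 * α * γ * δ))
      (3 * α * β ^ 2 + ε * (α * δ ^ 2 + 2 * β * γ * δ)) (β ^ 3 + ε * (β * δ ^ 2)) =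
      -4 * ε ^ 3 * (α * δ - β * γ) ^ 6 := by
  rw [cubicDisc]; ring

theorem tendsto_smul_slope {F : Type*} [NormedAddCommGroup F] [NormedSpace ℝ F]
    {g : ℝ × ℝ → F} {g' : ℝ × ℝ →L[ℝ] F} (hg : HasFDerivAt g g' 0) (h0 : g 0 = 0) (w : ℝ × ℝ) :
    Filter.Tendsto (fun s : ℝ => s⁻¹ • g (s • w)) (𝓝[≠] 0) (𝓝 (g' w)) := by
  have h1 : HasDerivAt (fun s : ℝ => s • w) w 0 := by
    simpa using (hasDerivAt_id (0 : ℝ)).smul_const w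
  have h2 : HasDerivAt (fun s : ℝ => g (s • w)) (g' w) 0 :=
    HasFDerivAt.comp_hasDerivAt (0 : ℝ) (by simpa using hg) h1
  simpa [h0] using h2.tendsto_slope_zero

/-- The cubic part of a germ right equivalent to `u³ + ε u v²` is nondegenerate. -/
theorem cubicDisc_ne_zero_of_rightEquivalent {k A B C D : ℝ × ℝ → ℝ} {ε : ℝ} (hε : ε ≠ 0)
    (hA : ContinuousAt A 0) (hB : ContinuousAt B 0) (hC : ContinuousAt C 0)
    (hD : ContinuousAt D 0)
    (hk : ∀ᶠ p in 𝓝 (0 : ℝ × ℝ), k p =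
      p.1 ^ 3 * A p + p.1 ^ 2 * p.2 * B p + p.1 * p.2 ^ 2 * C p + p.2 ^ 3 * D p)
    (h : RightEquivalent k (fun p => p.1 ^ 3 + ε * (p.1 * p.2 ^ 2))) :
    cubicDisc (A 0) (B 0) (C 0) (D 0) ≠ 0 := by
  obtain ⟨θ, hs, hθ0, hθ, hθ', hkθ⟩ := h
  have hd : HasFDerivAt θ (fderiv ℝ θ 0) 0 :=
    ((hθ.contDiffAt (θ.open_source.mem_nhds hs)).differentiableAt (by simp)).hasFDerivAt
  have hs' : (0 : ℝ × ℝ) ∈ θ.target := hθ0 ▸ θ.map_source hs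
  have hd' : HasFDerivAt θ.symm (fderiv ℝ θ.symm 0) (θ 0) := by
    rw [hθ0]
    exact ((hθ'.contDiffAt (θ.open_target.mem_nhds hs')).differentiableAt (by simp)).hasFDerivAt
  set Λ := fderiv ℝ θ 0
  have hcomp : (fderiv ℝ θ.symm 0).comp Λ = ContinuousLinearMap.id ℝ (ℝ × ℝ) := by
    refine (hd'.comp 0 hd).unique ((hasFDerivAt_id (0 : ℝ × ℝ)).congr_of_eventuallyEq ?_)
    filter_upwards [θ.open_source.mem_nhds hs] with p hp
    exact θ.left_inv hp
  have hinj : ∀ w, Λ w = 0 → w = 0 := by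
    intro w hw
    have := DFunLike.congr_fun hcomp w
    simpa [hw] using this.symm
  -- Both expressions for `k (s w)`, divided by `s³`, have limits as `s → 0`: the cubic part at `w`,
  -- and the model cubic at `Λ w`.
  have hcubic : ∀ w : ℝ × ℝ, w.1 ^ 3 * A 0 + w.1 ^ 2 * w.2 * B 0 + w.1 * w.2 ^ 2 * C 0
      + w.2 ^ 3 * D 0 = (Λ w).1 ^ 3 + ε * ((Λ w).1 * (Λ w).2 ^ 2) := by
    intro w
    have hline : Filter.Tendsto (fun s : ℝ => s • w) (𝓝[≠] 0) (𝓝 0) := by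
      have : Continuous fun s : ℝ => s • w := by fun_prop
      simpa using (this.tendsto 0).mono_left nhdsWithin_le_nhds
    have hθw := tendsto_smul_slope hd hθ0 w
    have hR : Filter.Tendsto (fun s : ℝ => (s⁻¹ • θ (s • w)).1 ^ 3 +
        ε * ((s⁻¹ • θ (s • w)).1 * (s⁻¹ • θ (s • w)).2 ^ 2)) (𝓝[≠] 0)
        (𝓝 ((Λ w).1 ^ 3 + ε * ((Λ w).1 * (Λ w).2 ^ 2))) :=
      (Continuous.tendsto (f := fun z : ℝ × ℝ => z.1 ^ 3 + ε * (z.1 * z.2 ^ 2))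
        (by fun_prop) (Λ w)).comp hθw
    have hL : Filter.Tendsto (fun s : ℝ => w.1 ^ 3 * A (s • w) + w.1 ^ 2 * w.2 * B (s • w)
        + w.1 * w.2 ^ 2 * C (s • w) + w.2 ^ 3 * D (s • w)) (𝓝[≠] 0)
        (𝓝 (w.1 ^ 3 * A 0 + w.1 ^ 2 * w.2 * B 0 + w.1 * w.2 ^ 2 * C 0 + w.2 ^ 3 * D 0)) :=
      ((((hA.tendsto.comp hline).const_mul _).add ((hB.tendsto.comp hline).const_mul _)).add
        ((hC.tendsto.comp hline).const_mul _)).add ((hD.tendsto.comp hline).const_mul _)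
    refine tendsto_nhds_unique (hL.congr' ?_) hR
    filter_upwards [hline.eventually hk, hline.eventually hkθ, self_mem_nhdsWithin] with s h1 h2 h3
    have h3' : s ≠ 0 := h3
    have h4 := h1.symm.trans h2
    simp only [Prod.smul_fst, Prod.smul_snd, smul_eq_mul] at h4 ⊢
    have h5 : s ^ 3 * (w.1 ^ 3 * A (s • w) + w.1 ^ 2 * w.2 * B (s • w)
        + w.1 * w.2 ^ 2 * C (s • w) + w.2 ^ 3 * D (s • w)) =
        (θ (s • w)).1 ^ 3 + ε * ((θ (s • w)).1 * (θ (s • w)).2 ^ 2) := by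
      rw [← h4]; ring
    field_simp
    linarith
  obtain ⟨α, γ, h10⟩ : ∃ α γ, Λ (1, 0) = (α, γ) := ⟨_, _, rfl⟩
  obtain ⟨β, δ, h01⟩ : ∃ β δ, Λ (0, 1) = (β, δ) := ⟨_, _, rfl⟩
  have hΛ : ∀ x y : ℝ, Λ (x, y) = (x * α + y * β, x * γ + y * δ) := by
    intro x y
    have : ((x, y) : ℝ × ℝ) = x • (1, 0) + y • (0, 1) := by simp
    rw [this, map_add, map_smul, map_smul, h10, h01]
    simp
  -- If the determinant vanished, `Λ` would kill `(δ, -γ)` and `(β, -α)`; injectivity would then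
  -- make every entry zero.
  have hdet : α * δ - β * γ ≠ 0 := by
    intro h
    have h1 := hinj (δ, -γ) (by rw [hΛ]; ext <;> simp <;> linarith)
    have h2 := hinj (β, -α) (by rw [hΛ]; ext <;> simp <;> linarith)
    simp only [Prod.mk_eq_zero, neg_eq_zero] at h1 h2
    have := hinj (1, 0) (by rw [h10, h2.2, h1.2]; rfl)
    simp at this
  have e1 := hcubic (1, 0)
  have e2 := hcubic (0, 1)
  have e3 := hcubic (1, 1)
  have e4 := hcubic (1, -1)
  simp only [hΛ] at e1 e2 e3 e4
  have ha : A 0 = α ^ 3 + ε * (α * γ ^ 2) := by linear_combination e1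
  have hd0 : D 0 = β ^ 3 + ε * (β * δ ^ 2) := by linear_combination e2
  have hb : B 0 = 3 * α ^ 2 * β + ε * (β * γ ^ 2 + 2 * α * γ * δ) := by
    linear_combination (e3 - e4) / 2 - e2
  have hc : C 0 = 3 * α * β ^ 2 + ε * (α * δ ^ 2 + 2 * β * γ * δ) := by
    linear_combination (e3 + e4) / 2 - e1
  rw [ha, hb, hc, hd0, cubicDisc_linear_substitution]
  exact mul_ne_zero (mul_ne_zero (by norm_num) (pow_ne_zero _ hε)) (pow_ne_zero _ hdet)

theorem hasD4Singularity_iff {k A B C D : ℝ × ℝ → ℝ}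
    (hA : SmoothGerm A 0) (hB : SmoothGerm B 0) (hC : SmoothGerm C 0) (hD : SmoothGerm D 0)
    (hk : ∀ᶠ p in 𝓝 (0 : ℝ × ℝ), k p =
      p.1 ^ 3 * A p + p.1 ^ 2 * p.2 * B p + p.1 * p.2 ^ 2 * C p + p.2 ^ 3 * D p)
    (hD0 : D 0 ≠ 0) :
    HasD4Singularity k ↔ cubicDisc (A 0) (B 0) (C 0) (D 0) ≠ 0 := by
  refine ⟨?_, hasD4Singularity_of_cubicDisc_ne_zero hA hB hC hD hk hD0⟩
  rintro (h | h)
  · exact cubicDisc_ne_zero_of_rightEquivalent one_ne_zero hA.contDiffAt.continuousAt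
      hB.contDiffAt.continuousAt hC.contDiffAt.continuousAt hD.contDiffAt.continuousAt hk
      (by simpa using h)
  · exact cubicDisc_ne_zero_of_rightEquivalent (neg_ne_zero.2 one_ne_zero)
      hA.contDiffAt.continuousAt
      hB.contDiffAt.continuousAt hC.contDiffAt.continuousAt hD.contDiffAt.continuousAt hk
      (by simpa [sub_eq_add_neg] using h)

/-! ### Closure properties of smooth germs. -/

section Germs

variable {E F : Type*} [NormedAddCommGroup E] [NormedSpace ℝ E]
  [NormedAddCommGroup F] [NormedSpace ℝ F]

theorem smoothGerm_of_contDiff {g : E → F} {x : E} (h : ContDiff ℝ ∞ g) : SmoothGerm g x :=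
  Filter.Eventually.of_forall fun _ => h.contDiffAt

theorem SmoothGerm.add {g h : E → F} {x : E} (hg : SmoothGerm g x) (hh : SmoothGerm h x) :
    SmoothGerm (fun p => g p + h p) x :=
  (hg.and hh).mono fun _ h => h.1.add h.2

theorem SmoothGerm.mul {g h : E → ℝ} {x : E} (hg : SmoothGerm g x) (hh : SmoothGerm h x) :
    SmoothGerm (fun p => g p * h p) x :=
  (hg.and hh).mono fun _ h => h.1.mul h.2

theorem SmoothGerm.neg {g : E → F} {x : E} (hg : SmoothGerm g x) :
    SmoothGerm (fun p => -g p) x :=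
  hg.mono fun _ h => h.neg

theorem SmoothGerm.sub {g h : E → F} {x : E} (hg : SmoothGerm g x) (hh : SmoothGerm h x) :
    SmoothGerm (fun p => g p - h p) x :=
  (hg.and hh).mono fun _ h => h.1.sub h.2

theorem SmoothGerm.differentiableAt {g : E → F} {x : E} (hg : SmoothGerm g x) :
    DifferentiableAt ℝ g x := hg.contDiffAt.differentiableAt (by simp)

theorem SmoothGerm.eventually_differentiableAt {g : E → F} {x : E} (hg : SmoothGerm g x) :
    ∀ᶠ p in 𝓝 x, DifferentiableAt ℝ g p := hg.mono fun _ h => h.differentiableAt (by simp)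

theorem SmoothGerm.fderiv_apply {g : E → F} {x : E} (hg : SmoothGerm g x) (w : E) :
    SmoothGerm (fun p => fderiv ℝ g p w) x :=
  hg.mono fun _ h => (h.fderiv_right (m := ∞) (by simp)).clm_apply contDiffAt_const

theorem SmoothGerm.du {g : ℝ × ℝ → F} {x : ℝ × ℝ} (hg : SmoothGerm g x) :
    SmoothGerm (du g) x := hg.fderiv_apply _

theorem SmoothGerm.dv {g : ℝ × ℝ → F} {x : ℝ × ℝ} (hg : SmoothGerm g x) :
    SmoothGerm (dv g) x := hg.fderiv_apply _

theorem smoothGerm_fst {x : ℝ × ℝ} : SmoothGerm (fun p : ℝ × ℝ => p.1) x :=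
  smoothGerm_of_contDiff contDiff_fst

theorem smoothGerm_snd {x : ℝ × ℝ} : SmoothGerm (fun p : ℝ × ℝ => p.2) x :=
  smoothGerm_of_contDiff contDiff_snd

theorem smoothGerm_const {x : E} (y : F) : SmoothGerm (fun _ : E => y) x :=
  smoothGerm_of_contDiff contDiff_const

theorem SmoothGerm.pow {g : E → ℝ} {x : E} (hg : SmoothGerm g x) (n : ℕ) :
    SmoothGerm (fun p => g p ^ n) x :=
  hg.mono fun _ h => h.pow n

theorem SmoothGerm.comp_fst {s : ℝ → F} (hs : SmoothGerm s 0) :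
    SmoothGerm (fun p : ℝ × ℝ => s p.1) 0 :=
  SmoothGerm.comp (h := fun p : ℝ × ℝ => p.1) hs smoothGerm_fst

end Germs

/-! ### First-order expansion of the principal curvature. -/

section PrincipalCurvature

/-- The first derivative at the origin of the root `2 H / (A + σ √R)` of the quadratic equation of
the principal curvatures. -/
theorem hasFDerivAt_root {E F G L M N : ℝ × ℝ → ℝ} {L' N' : ℝ × ℝ →L[ℝ] ℝ} {σ : ℝ}
    (hE : HasFDerivAt E (0 : ℝ × ℝ →L[ℝ] ℝ) 0) (hF : DifferentiableAt ℝ F 0) (hG : DifferentiableAt ℝ G 0)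
    (hL : HasFDerivAt L L' 0) (hM : DifferentiableAt ℝ M 0) (hN : HasFDerivAt N N' 0)
    (hE0 : E 0 = 1) (hF0 : F 0 = 0) (hG0 : G 0 = 1) (hσ : σ ^ 2 = 1) (hσN : 0 < σ * N 0) :
    HasFDerivAt (fun p => 2 * (L p * N p - p.2 * M p ^ 2) /
      (E p * N p - 2 * p.2 * F p * M p + p.2 * G p * L p
        + σ * √((E p * N p - 2 * p.2 * F p * M p + p.2 * G p * L p) ^ 2
          - 4 * p.2 * (E p * G p - F p ^ 2) * (L p * N p - p.2 * M p ^ 2))))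
      (L' - (M 0 ^ 2 / N 0) • ContinuousLinearMap.snd ℝ ℝ ℝ) 0 := by
  have hN0 : N 0 ≠ 0 := by rintro h; simp [h] at hσN
  have hσ0 : σ ≠ 0 := by rintro rfl; norm_num at hσ
  have hv : ∀ {g : ℝ × ℝ → ℝ}, DifferentiableAt ℝ g 0 →
      HasFDerivAt (fun p => g p * p.2) (g 0 • ContinuousLinearMap.snd ℝ ℝ ℝ) 0 :=
    fun hg => HasFDerivAt.mul_of_eq_zero hg hasFDerivAt_snd rfl
  let A : ℝ × ℝ → ℝ := fun p => E p * N p - 2 * p.2 * F p * M p + p.2 * G p * L p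
  let H : ℝ × ℝ → ℝ := fun p => L p * N p - p.2 * M p ^ 2
  let R : ℝ × ℝ → ℝ := fun p => A p ^ 2 - 4 * p.2 * (E p * G p - F p ^ 2) * H p
  have hA0 : A 0 = N 0 := by simp [A, hE0]
  have hH0 : H 0 = L 0 * N 0 := by simp [H]
  have hR0 : R 0 = N 0 ^ 2 := by simp [R, hA0]
  -- Here `σ` is the sign of `N 0`, so the root is `|N 0|` and the denominator becomes `2 N 0`
  -- instead of cancelling.
  have hsqrt : √(R 0) = σ * N 0 := by
    rw [hR0, show N 0 ^ 2 = (σ * N 0) ^ 2 by rw [mul_pow, hσ, one_mul], Real.sqrt_sq hσN.le]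
  have hA : HasFDerivAt A (N' + L 0 • ContinuousLinearMap.snd ℝ ℝ ℝ) 0 := by
    have h1 := (hE.mul hN).sub (hv (g := fun p => 2 * F p * M p) ((hF.const_mul 2).mul hM))
    have h2 := h1.add (hv (g := fun p => G p * L p) (hG.mul hL.differentiableAt))
    convert! h2 using 1
    · ext p; simp [A]; ring
    · ext <;> simp [hE0, hF0, hG0]
  have hH : HasFDerivAt H (L 0 • N' + N 0 • L' - M 0 ^ 2 • ContinuousLinearMap.snd ℝ ℝ ℝ) 0 := by
    have h1 := (hL.mul hN).sub (hv (g := fun p => M p ^ 2) (hM.pow 2))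
    convert! h1 using 1
    ext p; simp [H]; ring
  have hR : HasFDerivAt R ((2 * N 0) • (N' + L 0 • ContinuousLinearMap.snd ℝ ℝ ℝ)
      - (4 * (L 0 * N 0)) • ContinuousLinearMap.snd ℝ ℝ ℝ) 0 := by
    have hW : DifferentiableAt ℝ (fun p => 4 * (E p * G p - F p ^ 2) * H p) 0 :=
      (((hE.differentiableAt.mul hG).sub (hF.pow 2)).const_mul 4).mul hH.differentiableAt
    have h1 := (hA.pow 2).sub (hv hW)
    convert! h1 using 1
    · ext p; simp [R]; ring
    · ext <;> simp [hE0, hF0, hG0, hA0, hH0]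
  have hden : HasFDerivAt (fun p => A p + σ * √(R p)) _ 0 :=
    hA.add ((hR.sqrt (by rw [hR0]; exact pow_ne_zero _ hN0)).const_mul σ)
  have hden0 : A 0 + σ * √(R 0) = 2 * N 0 := by
    rw [hA0, hsqrt]; linear_combination N 0 * hσ
  have hden0' : A 0 + σ * √(R 0) ≠ 0 := by rw [hden0]; exact mul_ne_zero two_ne_zero hN0
  have := (hH.const_mul 2).mul ((hasDerivAt_inv hden0').comp_hasFDerivAt (0 : ℝ × ℝ) hden)
  have hinv : ((fun y => y⁻¹) ∘ fun p => A p + σ * √(R p)) 0 = (2 * N 0)⁻¹ := by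
    simp only [Function.comp_apply]; rw [hden0]
  rw [hinv, hden0, hsqrt, hH0] at this
  convert! this using 1
  ext <;> simp <;> field_simp <;> ring

end PrincipalCurvature

/-! ### Fundamental coefficients and the ridge condition in the frame `f_u = (1, a, b)`, `ψ = (0, 1,
c)`. -/

section Frame

theorem differentiableAt_vec3_and_fderiv {x y z : ℝ × ℝ → ℝ} {p : ℝ × ℝ} (hx : DifferentiableAt ℝ x p)
    (hy : DifferentiableAt ℝ y p) (hz : DifferentiableAt ℝ z p) :
    DifferentiableAt ℝ (fun q => (!₂[x q, y q, z q] : E3)) p ∧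
      ∀ w, fderiv ℝ (fun q => (!₂[x q, y q, z q] : E3)) p w =
        !₂[fderiv ℝ x p w, fderiv ℝ y p w, fderiv ℝ z p w] := by
  have hd : DifferentiableAt ℝ (fun q => (!₂[x q, y q, z q] : E3)) p := by
    rw [differentiableAt_euclidean]
    intro i
    fin_cases i
    exacts [hx, hy, hz]
  refine ⟨hd, fun w => ?_⟩
  have hcoord : ∀ i, fderiv ℝ (fun q => (!₂[x q, y q, z q] : E3)) p w i =
      fderiv ℝ (fun q => (!₂[x q, y q, z q] : E3) i) p w := fun i => by
    have := ((EuclideanSpace.proj i : E3 →L[ℝ] ℝ).hasFDerivAt.comp p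
      hd.hasFDerivAt).fderiv
    exact (DFunLike.congr_fun this w).symm
  ext i
  rw [hcoord]
  fin_cases i <;> rfl

theorem inner_vec3 (x y z x' y' z' : ℝ) :
    ⟪(!₂[x, y, z] : E3), !₂[x', y', z']⟫_ℝ = x * x' + y * y' + z * z' := by
  simp [PiLp.inner_apply, Fin.sum_univ_three]; ring

/-- Differentiating `⟨X, Y⟩ = 0` moves the derivative from the normal to the frame, so the
derivative of the normalising factor never appears in `L̂`, `M̂`, `N̂`. -/
theorem neg_inner_fderiv_of_orthogonal {X Y : ℝ × ℝ → E3} {p : ℝ × ℝ}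
    (hX : DifferentiableAt ℝ X p) (hY : DifferentiableAt ℝ Y p)
    (h : ∀ᶠ q in 𝓝 p, ⟪X q, Y q⟫_ℝ = 0) (w : ℝ × ℝ) :
    -⟪X p, fderiv ℝ Y p w⟫_ℝ = ⟪fderiv ℝ X p w, Y p⟫_ℝ := by
  have h1 := fderiv_inner_apply ℝ hX hY w
  have h2 : (fun q => ⟪X q, Y q⟫_ℝ) =ᶠ[𝓝 p] fun _ => (0 : ℝ) := h
  rw [h2.fderiv_eq] at h1
  simp only [fderiv_fun_const, Pi.zero_apply, zero_apply] at h1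
  linarith

/-- The reciprocal of the length of `(1, a, b) × (0, 1, c)`. -/
def normalScale (a b c : ℝ × ℝ → ℝ) (p : ℝ × ℝ) : ℝ :=
  (√((a p * c p - b p) ^ 2 + c p ^ 2 + 1))⁻¹

variable {f : ℝ × ℝ → E3} {a b c : ℝ × ℝ → ℝ}

theorem smoothGerm_normalScale (ha : SmoothGerm a 0) (hb : SmoothGerm b 0)
    (hc : SmoothGerm c 0) : SmoothGerm (normalScale a b c) 0 := by
  filter_upwards [ha, hb, hc] with p h1 h2 h3
  have hpos : 0 < (a p * c p - b p) ^ 2 + c p ^ 2 + 1 := by positivity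
  exact (((((h1.mul h3).sub h2).pow 2).add (h3.pow 2)).add contDiffAt_const).sqrt hpos.ne'
    |>.inv (Real.sqrt_pos.2 hpos).ne'

theorem normalScale_zero (hb0 : b 0 = 0) (hc0 : c 0 = 0) : normalScale a b c 0 = 1 := by
  simp [normalScale, hb0, hc0]

/-- The radicand is `1` plus squares of functions vanishing at the origin, so there is no
first-order term. -/
theorem hasFDerivAt_normalScale (ha : SmoothGerm a 0) (hb : SmoothGerm b 0)
    (hc : SmoothGerm c 0) (hb0 : b 0 = 0) (hc0 : c 0 = 0) :
    HasFDerivAt (normalScale a b c) (0 : ℝ × ℝ →L[ℝ] ℝ) 0 := by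
  have ha' := ha.differentiableAt
  have hb' := hb.differentiableAt
  have hc' := hc.differentiableAt
  have h1 : HasFDerivAt (fun p => (a p * c p - b p) ^ 2 + c p ^ 2 + 1)
      (0 : ℝ × ℝ →L[ℝ] ℝ) 0 := by
    have := ((((ha'.mul hc').sub hb').hasFDerivAt.pow 2).add (hc'.hasFDerivAt.pow 2)).add_const 1
    convert! this using 1
    simp [hb0, hc0]
  have h2 := h1.sqrt (by positivity)
  have h3 := (hasDerivAt_inv (x := √((a 0 * c 0 - b 0) ^ 2 + c 0 ^ 2 + 1))
    (by positivity)).comp_hasFDerivAt (0 : ℝ × ℝ) h2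
  convert! h3 using 1
  simp

theorem normal_eventuallyEq (hu : du f =ᶠ[𝓝 0] fun p => !₂[1, a p, b p])
    (hψ : psi f =ᶠ[𝓝 0] fun p => !₂[0, 1, c p]) :
    normal f =ᶠ[𝓝 0] fun p => !₂[normalScale a b c p * (a p * c p - b p),
      -(normalScale a b c p * c p), normalScale a b c p] := by
  filter_upwards [hu, hψ] with p h1 h2
  have hcr : cross (du f p) (psi f p) = !₂[a p * c p - b p, -c p, 1] := by
    rw [h1, h2, cross]
    ext i
    fin_cases i <;> simp [cross_apply]
  have hn : ‖cross (du f p) (psi f p)‖⁻¹ = normalScale a b c p := by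
    rw [hcr, normalScale, EuclideanSpace.norm_eq]
    simp [Fin.sum_univ_three]
  rw [normal, hn, hcr]
  ext i
  fin_cases i <;> simp

theorem coeff_eventuallyEq (hu : du f =ᶠ[𝓝 0] fun p => !₂[1, a p, b p])
    (hψ : psi f =ᶠ[𝓝 0] fun p => !₂[0, 1, c p])
    (ha : SmoothGerm a 0) (hb : SmoothGerm b 0) (hc : SmoothGerm c 0) :
    ∀ᶠ p in 𝓝 0, coeffE f p = 1 + a p ^ 2 + b p ^ 2 ∧ coeffF f p = a p + b p * c p ∧
      coeffG f p = 1 + c p ^ 2 ∧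
      coeffL f p = normalScale a b c p * (du b p - c p * du a p) ∧
      coeffM f p = normalScale a b c p * du c p ∧
      coeffN f p = normalScale a b c p * dv c p := by
  have hν := normal_eventuallyEq hu hψ
  have hρ := smoothGerm_normalScale ha hb hc
  filter_upwards [hu.eventually_nhds, hψ.eventually_nhds, hν.eventually_nhds,
    ha.eventually_differentiableAt, hb.eventually_differentiableAt,
    hc.eventually_differentiableAt, hρ.eventually_differentiableAt]
    with p hu hψ hν ha hb hc hρ
  have hu' := hu.self_of_nhds
  have hψ' := hψ.self_of_nhds
  have hν' := hν.self_of_nhds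
  have hu : du f =ᶠ[𝓝 p] fun p => !₂[1, a p, b p] := hu
  have hψ : psi f =ᶠ[𝓝 p] fun p => !₂[0, 1, c p] := hψ
  have hν : normal f =ᶠ[𝓝 p] fun p => !₂[normalScale a b c p * (a p * c p - b p),
      -(normalScale a b c p * c p), normalScale a b c p] := hν
  obtain ⟨du1, du2⟩ := differentiableAt_vec3_and_fderiv (differentiableAt_const (1 : ℝ)) ha hb
  obtain ⟨dψ1, dψ2⟩ := differentiableAt_vec3_and_fderiv (differentiableAt_const (0 : ℝ))
    (differentiableAt_const (1 : ℝ)) hc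
  have dν := (differentiableAt_vec3_and_fderiv (hρ.mul ((ha.mul hc).sub hb)) (hρ.mul hc).neg hρ).1
  have eu := neg_inner_fderiv_of_orthogonal (du1.congr_of_eventuallyEq hu)
    (dν.congr_of_eventuallyEq hν) (by
      filter_upwards [hu, hν] with q h1 h2
      rw [h1, h2, inner_vec3]; simp; try ring)
  have eψ := neg_inner_fderiv_of_orthogonal (dψ1.congr_of_eventuallyEq hψ)
    (dν.congr_of_eventuallyEq hν) (by
      filter_upwards [hψ, hν] with q h1 h2
      rw [h1, h2, inner_vec3]; simp; try ring)
  refine ⟨?_, ?_, ?_, ?_, ?_, ?_⟩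
  · rw [coeffE, hu', inner_vec3]; ring
  · rw [coeffF, hu', hψ', inner_vec3]; ring
  · rw [coeffG, hψ', inner_vec3]; ring
  · refine (eu (1, 0)).trans ?_
    rw [hu.fderiv_eq, du2, hν', inner_vec3]
    simp [du]; try ring
  · refine (eψ (1, 0)).trans ?_
    rw [hψ.fderiv_eq, dψ2, hν', inner_vec3]
    simp [du]; try ring
  · refine (eψ (0, 1)).trans ?_
    rw [hψ.fderiv_eq, dψ2, hν', inner_vec3]
    simp [dv]; try ring

theorem coeff_zero (hu : du f =ᶠ[𝓝 0] fun p => !₂[1, a p, b p])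
    (hψ : psi f =ᶠ[𝓝 0] fun p => !₂[0, 1, c p])
    (ha : SmoothGerm a 0) (hb : SmoothGerm b 0) (hc : SmoothGerm c 0)
    (ha0 : a 0 = 0) (hb0 : b 0 = 0) (hc0 : c 0 = 0) :
    coeffE f 0 = 1 ∧ coeffF f 0 = 0 ∧ coeffG f 0 = 1 ∧ coeffL f 0 = du b 0 ∧
      coeffM f 0 = du c 0 ∧ coeffN f 0 = dv c 0 := by
  obtain ⟨h1, h2, h3, h4, h5, h6⟩ := (coeff_eventuallyEq hu hψ ha hb hc).self_of_nhds
  rw [normalScale_zero hb0 hc0] at h4 h5 h6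
  rw [h1, h2, h3, h4, h5, h6]
  simp [ha0, hb0, hc0]

theorem normal_zero (hu : du f =ᶠ[𝓝 0] fun p => !₂[1, a p, b p])
    (hψ : psi f =ᶠ[𝓝 0] fun p => !₂[0, 1, c p]) (hb0 : b 0 = 0) (hc0 : c 0 = 0) :
    normal f 0 = !₂[0, 0, 1] := by
  refine (normal_eventuallyEq hu hψ).self_of_nhds.trans ?_
  simp [normalScale_zero hb0 hc0, hb0, hc0]

theorem principalCurvature_zero (hu : du f =ᶠ[𝓝 0] fun p => !₂[1, a p, b p])
    (hψ : psi f =ᶠ[𝓝 0] fun p => !₂[0, 1, c p])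
    (ha : SmoothGerm a 0) (hb : SmoothGerm b 0) (hc : SmoothGerm c 0)
    (ha0 : a 0 = 0) (hb0 : b 0 = 0) (hc0 : c 0 = 0) (hcv : dv c 0 ≠ 0) :
    principalCurvature f 0 = du b 0 := by
  obtain ⟨h1, h2, h3, h4, h5, h6⟩ := coeff_zero hu hψ ha hb hc ha0 hb0 hc0
  have hA : coeffA f 0 = dv c 0 := by simp [coeffA, h1, h6]
  have hR : radicand f 0 = dv c 0 ^ 2 := by simp [radicand, hA]
  rw [principalCurvature, h6]
  split_ifs with h
  · rw [kappa₂, coeffB, hR, Real.sqrt_sq h.le, hA, h4, h6]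
    simp only [Prod.snd_zero, zero_mul, sub_zero]
    field_simp
    ring
  · have h' : dv c 0 < 0 := lt_of_le_of_ne (not_lt.1 h) hcv
    rw [kappa₁, coeffB, hR, ← neg_sq (dv c 0), Real.sqrt_sq (by linarith), hA, h4, h6]
    simp only [Prod.snd_zero, zero_mul, sub_zero]
    field_simp
    ring

theorem hasFDerivAt_principalCurvature (hu : du f =ᶠ[𝓝 0] fun p => !₂[1, a p, b p])
    (hψ : psi f =ᶠ[𝓝 0] fun p => !₂[0, 1, c p])
    (ha : SmoothGerm a 0) (hb : SmoothGerm b 0) (hc : SmoothGerm c 0)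
    (ha0 : a 0 = 0) (hb0 : b 0 = 0) (hc0 : c 0 = 0) (hcv : dv c 0 ≠ 0) :
    HasFDerivAt (principalCurvature f) (fderiv ℝ (du b) 0 - du a 0 • fderiv ℝ c 0
      - (du c 0 ^ 2 / dv c 0) • ContinuousLinearMap.snd ℝ ℝ ℝ) 0 := by
  obtain ⟨h1, h2, h3, h4, h5, h6⟩ := coeff_zero hu hψ ha hb hc ha0 hb0 hc0
  have hev := coeff_eventuallyEq hu hψ ha hb hc
  have ha' := ha.differentiableAt
  have hb' := hb.differentiableAt
  have hc' := hc.differentiableAt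
  have hρ := hasFDerivAt_normalScale ha hb hc hb0 hc0
  have hρ0 := normalScale_zero (a := a) hb0 hc0
  have hE : HasFDerivAt (coeffE f) (0 : ℝ × ℝ →L[ℝ] ℝ) 0 := by
    have : HasFDerivAt (fun p => 1 + a p ^ 2 + b p ^ 2) (0 : ℝ × ℝ →L[ℝ] ℝ) 0 := by
      convert! ((ha'.hasFDerivAt.pow 2).const_add 1).add (hb'.hasFDerivAt.pow 2) using 1
      simp [ha0, hb0]
    exact this.congr_of_eventuallyEq (hev.mono fun _ h => h.1)
  have hF : DifferentiableAt ℝ (coeffF f) 0 :=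
    (ha'.add (hb'.mul hc')).congr_of_eventuallyEq (hev.mono fun _ h => h.2.1)
  have hG : DifferentiableAt ℝ (coeffG f) 0 :=
    ((differentiableAt_const (1 : ℝ)).add (hc'.pow 2)).congr_of_eventuallyEq
      (hev.mono fun _ h => h.2.2.1)
  have hL : HasFDerivAt (coeffL f) (fderiv ℝ (du b) 0 - du a 0 • fderiv ℝ c 0) 0 := by
    have : HasFDerivAt (fun p => normalScale a b c p * (du b p - c p * du a p))
        (fderiv ℝ (du b) 0 - du a 0 • fderiv ℝ c 0) 0 := by
      convert! hρ.mul (hb.du.differentiableAt.hasFDerivAt.sub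
        (hc'.hasFDerivAt.mul ha.du.differentiableAt.hasFDerivAt)) using 1
      simp [hρ0, hc0]
    exact this.congr_of_eventuallyEq (hev.mono fun _ h => h.2.2.2.1)
  have hM : DifferentiableAt ℝ (coeffM f) 0 :=
    (hρ.differentiableAt.mul hc.du.differentiableAt).congr_of_eventuallyEq
      (hev.mono fun _ h => h.2.2.2.2.1)
  have hN : DifferentiableAt ℝ (coeffN f) 0 :=
    (hρ.differentiableAt.mul hc.dv.differentiableAt).congr_of_eventuallyEq
      (hev.mono fun _ h => h.2.2.2.2.2)
  rw [← h5, ← h6, principalCurvature]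
  split_ifs with h
  · convert! hasFDerivAt_root (σ := 1) hE hF hG hL hM hN.hasFDerivAt h1 h2 h3 (by norm_num)
      (by linarith) using 1
    ext p
    simp [kappa₂, coeffB, radicand, coeffA]
  · have h' : coeffN f 0 < 0 := lt_of_le_of_ne (not_lt.1 h) (h6 ▸ hcv)
    convert! hasFDerivAt_root (σ := -1) hE hF hG hL hM hN.hasFDerivAt h1 h2 h3 (by norm_num)
      (by linarith) using 1
    ext p
    simp [kappa₁, coeffB, radicand, coeffA, sub_eq_add_neg]

/-- The principal direction at `0` is `(c_v, -c_u)`, which annihilates `dc`; hence the `a_u dc` term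
of the derivative drops out. Multiplying the rest by `c_v ≠ 0` clears the denominator. -/
theorem isRidgePoint_iff (hu : du f =ᶠ[𝓝 0] fun p => !₂[1, a p, b p])
    (hψ : psi f =ᶠ[𝓝 0] fun p => !₂[0, 1, c p])
    (ha : SmoothGerm a 0) (hb : SmoothGerm b 0) (hc : SmoothGerm c 0)
    (ha0 : a 0 = 0) (hb0 : b 0 = 0) (hc0 : c 0 = 0) (hcv : dv c 0 ≠ 0) :
    IsRidgePoint f ↔ dv c 0 ^ 2 * du (du b) 0 - dv c 0 * du c 0 * dv (du b) 0
      + du c 0 ^ 3 = 0 := by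
  obtain ⟨h1, h2, h3, h4, h5, h6⟩ := coeff_zero hu hψ ha hb hc ha0 hb0 hc0
  have hdir : principalDirection f 0 = dv c 0 • ((1, 0) : ℝ × ℝ) + (-du c 0) • ((0, 1) : ℝ × ℝ) := by
    rw [principalDirection, h2, h3, h5, h6]
    simp
  rw [IsRidgePoint, (hasFDerivAt_principalCurvature hu hψ ha hb hc ha0 hb0 hc0 hcv).fderiv, hdir,
    map_add, map_smul, map_smul]
  have e1 : fderiv ℝ c 0 (1, 0) = du c 0 := rfl
  have e2 : fderiv ℝ c 0 (0, 1) = dv c 0 := rfl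
  have e3 : fderiv ℝ (du b) 0 (1, 0) = du (du b) 0 := rfl
  have e4 : fderiv ℝ (du b) 0 (0, 1) = dv (du b) 0 := rfl
  simp only [sub_apply, smul_apply, ContinuousLinearMap.coe_snd', e1, e2, e3, e4, smul_eq_mul]
  constructor
  · intro h
    field_simp at h
    linear_combination h
  · intro h
    field_simp
    linear_combination h

end Frame

/-! ### Partial derivatives of functions `u² S + v² T`. -/

section Partials

theorem du_mul {g h : ℝ × ℝ → ℝ} {p : ℝ × ℝ} (hg : DifferentiableAt ℝ g p)
    (hh : DifferentiableAt ℝ h p) : du (fun q => g q * h q) p = g p * du h p + h p * du g p := by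
  simp [du, fderiv_fun_mul hg hh]

theorem dv_mul {g h : ℝ × ℝ → ℝ} {p : ℝ × ℝ} (hg : DifferentiableAt ℝ g p)
    (hh : DifferentiableAt ℝ h p) : dv (fun q => g q * h q) p = g p * dv h p + h p * dv g p := by
  simp [dv, fderiv_fun_mul hg hh]

theorem du_add {g h : ℝ × ℝ → ℝ} {p : ℝ × ℝ} (hg : DifferentiableAt ℝ g p)
    (hh : DifferentiableAt ℝ h p) : du (fun q => g q + h q) p = du g p + du h p := by
  simp [du, fderiv_fun_add hg hh]

theorem dv_add {g h : ℝ × ℝ → ℝ} {p : ℝ × ℝ} (hg : DifferentiableAt ℝ g p)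
    (hh : DifferentiableAt ℝ h p) : dv (fun q => g q + h q) p = dv g p + dv h p := by
  simp [dv, fderiv_fun_add hg hh]

theorem du_fst (p : ℝ × ℝ) : du (fun q : ℝ × ℝ => q.1) p = 1 := by
  simp [du, fderiv_fst]

theorem dv_fst (p : ℝ × ℝ) : dv (fun q : ℝ × ℝ => q.1) p = 0 := by
  simp [dv, fderiv_fst]

theorem du_snd (p : ℝ × ℝ) : du (fun q : ℝ × ℝ => q.2) p = 0 := by
  simp [du, fderiv_snd]

theorem dv_snd (p : ℝ × ℝ) : dv (fun q : ℝ × ℝ => q.2) p = 1 := by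
  simp [dv, fderiv_snd]

theorem du_const (r : ℝ) (p : ℝ × ℝ) : du (fun _ : ℝ × ℝ => r) p = 0 := by
  simp [du]

theorem dv_const (r : ℝ) (p : ℝ × ℝ) : dv (fun _ : ℝ × ℝ => r) p = 0 := by
  simp [dv]

theorem du_fst_mul_zero {h : ℝ × ℝ → ℝ} (hh : DifferentiableAt ℝ h 0) :
    du (fun q => q.1 * h q) 0 = h 0 := by
  rw [du_mul differentiableAt_fst hh, du_fst]; simp

theorem dv_fst_mul_zero {h : ℝ × ℝ → ℝ} (hh : DifferentiableAt ℝ h 0) :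
    dv (fun q => q.1 * h q) 0 = 0 := by
  rw [dv_mul differentiableAt_fst hh, dv_fst]; simp

theorem du_snd_mul_zero {h : ℝ × ℝ → ℝ} (hh : DifferentiableAt ℝ h 0) :
    du (fun q => q.2 * h q) 0 = 0 := by
  rw [du_mul differentiableAt_snd hh, du_snd]; simp

theorem dv_snd_mul_zero {h : ℝ × ℝ → ℝ} (hh : DifferentiableAt ℝ h 0) :
    dv (fun q => q.2 * h q) 0 = h 0 := by
  rw [dv_mul differentiableAt_snd hh, dv_snd]; simp

theorem dv_comp_fst {s : ℝ → ℝ} {p : ℝ × ℝ} (hs : DifferentiableAt ℝ s p.1) :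
    dv (fun q : ℝ × ℝ => s q.1) p = 0 := by
  have := hs.hasFDerivAt.comp p (hasFDerivAt_fst (𝕜 := ℝ) (p := p))
  have h2 : dv (fun q : ℝ × ℝ => s q.1) p = _ := DFunLike.congr_fun this.fderiv (0, 1)
  rw [h2]; simp

theorem du_eventuallyEq {g h : ℝ × ℝ → ℝ} {p : ℝ × ℝ} (hgh : g =ᶠ[𝓝 p] h) :
    du g =ᶠ[𝓝 p] du h := by
  filter_upwards [hgh.fderiv (𝕜 := ℝ)] with q hq
  rw [du, hq, du]

theorem dv_eventuallyEq {g h : ℝ × ℝ → ℝ} {p : ℝ × ℝ} (hgh : g =ᶠ[𝓝 p] h) :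
    dv g =ᶠ[𝓝 p] dv h := by
  filter_upwards [hgh.fderiv (𝕜 := ℝ)] with q hq
  rw [dv, hq, dv]

/-- Functions of the form `u² S + v² T`: the coordinate functions of a cuspidal edge. -/
theorem du_quadratic {S T : ℝ × ℝ → ℝ} (hS : SmoothGerm S 0) (hT : SmoothGerm T 0) :
    du (fun p => p.1 ^ 2 * S p + p.2 ^ 2 * T p) =ᶠ[𝓝 0]
      fun p => p.1 * (2 * S p + p.1 * du S p) + p.2 * (p.2 * du T p) := by
  filter_upwards [hS.eventually_differentiableAt, hT.eventually_differentiableAt] with p h1 h2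
  have e : (fun p : ℝ × ℝ => p.1 ^ 2 * S p + p.2 ^ 2 * T p) =
      fun p => p.1 * (p.1 * S p) + p.2 * (p.2 * T p) := by ext; ring
  have d1 : DifferentiableAt ℝ (fun q : ℝ × ℝ => q.1 * S q) p := differentiableAt_fst.fun_mul h1
  have d2 : DifferentiableAt ℝ (fun q : ℝ × ℝ => q.2 * T q) p := differentiableAt_snd.fun_mul h2
  rw [e, du_add (differentiableAt_fst.fun_mul d1) (differentiableAt_snd.fun_mul d2),
    du_mul differentiableAt_fst d1, du_mul differentiableAt_fst h1,
    du_mul differentiableAt_snd d2, du_mul differentiableAt_snd h2, du_fst, du_snd]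
  ring

theorem dv_quadratic {s : ℝ → ℝ} {T : ℝ × ℝ → ℝ} (hs : SmoothGerm s 0) (hT : SmoothGerm T 0) :
    dv (fun p => p.1 ^ 2 * s p.1 + p.2 ^ 2 * T p) =ᶠ[𝓝 0]
      fun p => p.2 * (2 * T p + p.2 * dv T p) := by
  have hs' : ∀ᶠ p : ℝ × ℝ in 𝓝 0, DifferentiableAt ℝ s p.1 :=
    (continuousAt_fst (p := ((0 : ℝ), (0 : ℝ)))).eventually hs.eventually_differentiableAt
  filter_upwards [hs', hT.eventually_differentiableAt] with p h1 h2
  have e : (fun p : ℝ × ℝ => p.1 ^ 2 * s p.1 + p.2 ^ 2 * T p) =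
      fun p => p.1 ^ 2 * s p.1 + p.2 * (p.2 * T p) := by ext; ring
  have d1 : DifferentiableAt ℝ (fun x : ℝ => x ^ 2 * s x) p.1 :=
    (differentiableAt_id.pow 2).mul h1
  have d2 : DifferentiableAt ℝ (fun q : ℝ × ℝ => q.2 * T q) p := differentiableAt_snd.fun_mul h2
  have d3 : DifferentiableAt ℝ (fun q : ℝ × ℝ => q.1 ^ 2 * s q.1) p :=
    d1.comp p differentiableAt_fst
  rw [e, dv_add d3 (differentiableAt_snd.fun_mul d2), dv_comp_fst d1,
    dv_mul differentiableAt_snd d2, dv_mul differentiableAt_snd h2, dv_snd]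
  ring

/-- The derivatives of `u² S + v² T` at the origin. -/
theorem quadratic_jet {S T : ℝ × ℝ → ℝ} (hS : SmoothGerm S 0) (hT : SmoothGerm T 0) :
    du (fun p => p.1 ^ 2 * S p + p.2 ^ 2 * T p) 0 = 0 ∧
    du (du (fun p => p.1 ^ 2 * S p + p.2 ^ 2 * T p)) 0 = 2 * S 0 ∧
    du (du (du (fun p => p.1 ^ 2 * S p + p.2 ^ 2 * T p))) 0 = 6 * du S 0 ∧
    dv (du (du (fun p => p.1 ^ 2 * S p + p.2 ^ 2 * T p))) 0 = 2 * dv S 0 := by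
  have e1 := du_quadratic hS hT
  have hSu := hS.du
  have hTu := hT.du
  have hm1 : SmoothGerm (fun p => 2 * S p + p.1 * du S p) 0 :=
    ((smoothGerm_const 2).mul hS).add (smoothGerm_fst.mul hSu)
  have hm2 : SmoothGerm (fun p => p.2 * du T p) 0 := smoothGerm_snd.mul hTu
  have e2 : du (du (fun p => p.1 ^ 2 * S p + p.2 ^ 2 * T p)) =ᶠ[𝓝 0]
      fun p => (2 * S p + p.1 * (4 * du S p + p.1 * du (du S) p)) +
        p.2 * (p.2 * du (du T) p) := by
    refine (du_eventuallyEq e1).trans ?_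
    filter_upwards [hS.eventually_differentiableAt, hSu.eventually_differentiableAt,
      hTu.eventually_differentiableAt, hm1.eventually_differentiableAt,
      hm2.eventually_differentiableAt] with p h1 h2 h3 h4 h5
    have d : DifferentiableAt ℝ (fun q : ℝ × ℝ => q.1 * du S q) p := differentiableAt_fst.fun_mul h2
    rw [du_add (differentiableAt_fst.fun_mul h4) (differentiableAt_snd.fun_mul h5),
      du_mul differentiableAt_fst h4, du_mul differentiableAt_snd h5, du_fst, du_snd,
      du_mul differentiableAt_snd h3, du_snd, du_add (h1.const_mul 2) d,
      du_mul (differentiableAt_const _) h1, du_const, du_mul differentiableAt_fst h2, du_fst]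
    ring
  have k1 : DifferentiableAt ℝ (fun p : ℝ × ℝ => 4 * du S p + p.1 * du (du S) p) 0 :=
    (((smoothGerm_const 4).mul hSu).add (smoothGerm_fst.mul hSu.du)).differentiableAt
  have k2 : DifferentiableAt ℝ (fun p : ℝ × ℝ => p.2 * du (du T) p) 0 :=
    (smoothGerm_snd.mul hTu.du).differentiableAt
  have k3 : DifferentiableAt ℝ (fun p : ℝ × ℝ => p.1 * (4 * du S p + p.1 * du (du S) p)) 0 :=
    differentiableAt_fst.fun_mul k1
  have k4 : DifferentiableAt ℝ (fun p : ℝ × ℝ => p.2 * (p.2 * du (du T) p)) 0 :=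
    differentiableAt_snd.fun_mul k2
  have k5 : DifferentiableAt ℝ (fun p : ℝ × ℝ => 2 * S p) 0 := hS.differentiableAt.const_mul 2
  refine ⟨?_, ?_, ?_, ?_⟩
  · rw [e1.self_of_nhds]; simp
  · rw [e2.self_of_nhds]; simp
  · rw [(du_eventuallyEq e2).self_of_nhds, du_add (k5.fun_add k3) k4, du_add k5 k3,
      du_mul (differentiableAt_const _) hS.differentiableAt, du_const, du_fst_mul_zero k1,
      du_snd_mul_zero k2]
    simp; ring
  · rw [(dv_eventuallyEq e2).self_of_nhds, dv_add (k5.fun_add k3) k4, dv_add k5 k3,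
      dv_mul (differentiableAt_const _) hS.differentiableAt, dv_const, dv_fst_mul_zero k1,
      dv_snd_mul_zero k2]
    simp

end Partials

/-! ### The frame `f_u`, `ψ` of a map with first coordinate `u`. -/

section AdaptedFrame

variable {f : ℝ × ℝ → E3} {x y c : ℝ × ℝ → ℝ}

theorem du_eventuallyEq_vec3 (hf : f =ᶠ[𝓝 0] fun p => !₂[p.1, x p, y p])
    (hx : SmoothGerm x 0) (hy : SmoothGerm y 0) :
    du f =ᶠ[𝓝 0] fun p => !₂[1, du x p, du y p] := by
  filter_upwards [hf.fderiv (𝕜 := ℝ), hx.eventually_differentiableAt, hy.eventually_differentiableAt]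
    with p h1 h2 h3
  rw [du, h1, (differentiableAt_vec3_and_fderiv differentiableAt_fst h2 h3).2,
    show fderiv ℝ (fun q : ℝ × ℝ => q.1) p (1, 0) = 1 from du_fst p]
  rfl

theorem psi_eventuallyEq_vec3 (hf : f =ᶠ[𝓝 0] fun p => !₂[p.1, x p, y p])
    (hx : SmoothGerm x 0) (hy : SmoothGerm y 0) (hc : SmoothGerm c 0)
    (hxv : dv x =ᶠ[𝓝 0] fun p => p.2) (hyv : dv y =ᶠ[𝓝 0] fun p => p.2 * c p) :
    psi f =ᶠ[𝓝 0] fun p => !₂[0, 1, c p] := by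
  have hdv : dv f =ᶠ[𝓝 0] fun p => !₂[0, p.2, p.2 * c p] := by
    filter_upwards [hf.fderiv (𝕜 := ℝ), hx.eventually_differentiableAt, hy.eventually_differentiableAt,
      hxv, hyv] with p h1 h2 h3 h4 h5
    rw [dv, h1, (differentiableAt_vec3_and_fderiv differentiableAt_fst h2 h3).2, ← h5, ← h4,
      show fderiv ℝ (fun q : ℝ × ℝ => q.1) p (0, 1) = 0 from dv_fst p]
    rfl
  filter_upwards [hdv, hdv.fderiv (𝕜 := ℝ), hc.eventually_differentiableAt] with p h1 h2 h3
  rw [psi]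
  split_ifs with h
  -- On the axis `ψ` is `f_vv`, and the `v`-derivative of `v c` at `v = 0` is `c`, in agreement with
  -- `f_v / v` off the axis.
  · have hp : dv (fun q : ℝ × ℝ => q.2 * c q) p = c p := by
      rw [dv_mul differentiableAt_snd h3, dv_snd, h]; simp
    rw [dv, h2, (differentiableAt_vec3_and_fderiv (differentiableAt_const (0 : ℝ)) differentiableAt_snd
      (differentiableAt_snd.fun_mul h3)).2,
      show fderiv ℝ (fun q : ℝ × ℝ => q.2) p (0, 1) = 1 from dv_snd p,
      show fderiv ℝ (fun q : ℝ × ℝ => q.2 * c q) p (0, 1) = c p from hp,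
      show fderiv ℝ (fun _ : ℝ × ℝ => (0 : ℝ)) p (0, 1) = 0 from dv_const 0 p]
  · rw [h1]
    ext i
    fin_cases i <;> simp [h]

end AdaptedFrame

/-! ### Invariants of the cuspidal edge and the cubic part of the distance squared function. -/

section DistanceSquared

variable {f : ℝ × ℝ → E3} {s τ : ℝ → ℝ} {γ δ : ℝ × ℝ → ℝ} {β : ℝ}

/-- The invariants at the origin of a cuspidal edge
`(u, u² s + v² / 2, u² (β + u τ) + v² (u γ + v δ))`. -/
theorem cuspidalEdge_invariants
    (hf : f =ᶠ[𝓝 0] fun p => !₂[p.1, p.1 ^ 2 * s p.1 + p.2 ^ 2 * (1 / 2),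
      p.1 ^ 2 * (β + p.1 * τ p.1) + p.2 ^ 2 * (p.1 * γ p + p.2 * δ p)])
    (hs : SmoothGerm s 0) (hτ : SmoothGerm τ 0) (hγ : SmoothGerm γ 0) (hδ : SmoothGerm δ 0)
    (hδ0 : δ 0 ≠ 0) :
    normal f 0 = !₂[0, 0, 1] ∧ principalCurvature f 0 = 2 * β ∧
      (IsRidgePoint f ↔ 27 * τ 0 * δ 0 ^ 2 + 4 * γ 0 ^ 3 = 0) := by
  have hS : SmoothGerm (fun p : ℝ × ℝ => s p.1) 0 := hs.comp_fst
  have hτ' : SmoothGerm (fun p : ℝ × ℝ => τ p.1) 0 := hτ.comp_fst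
  have hσ : SmoothGerm (fun u : ℝ => β + u * τ u) 0 :=
    (smoothGerm_const β).add ((smoothGerm_of_contDiff contDiff_id).mul hτ)
  have hσ' : SmoothGerm (fun p : ℝ × ℝ => β + p.1 * τ p.1) 0 := hσ.comp_fst
  have hT₂ : SmoothGerm (fun _ : ℝ × ℝ => (1 / 2 : ℝ)) 0 := smoothGerm_const _
  have hT₃ : SmoothGerm (fun p : ℝ × ℝ => p.1 * γ p + p.2 * δ p) 0 :=
    (smoothGerm_fst.mul hγ).add (smoothGerm_snd.mul hδ)
  have hx : SmoothGerm (fun p : ℝ × ℝ => p.1 ^ 2 * s p.1 + p.2 ^ 2 * (1 / 2)) 0 :=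
    ((smoothGerm_fst.pow 2).mul hS).add ((smoothGerm_snd.pow 2).mul hT₂)
  have hy : SmoothGerm (fun p : ℝ × ℝ =>
      p.1 ^ 2 * (β + p.1 * τ p.1) + p.2 ^ 2 * (p.1 * γ p + p.2 * δ p)) 0 :=
    ((smoothGerm_fst.pow 2).mul hσ').add ((smoothGerm_snd.pow 2).mul hT₃)
  have hc : SmoothGerm (fun p => 2 * (p.1 * γ p + p.2 * δ p) +
      p.2 * dv (fun p : ℝ × ℝ => p.1 * γ p + p.2 * δ p) p) 0 :=
    ((smoothGerm_const 2).mul hT₃).add (smoothGerm_snd.mul hT₃.dv)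
  have hxv : dv (fun p : ℝ × ℝ => p.1 ^ 2 * s p.1 + p.2 ^ 2 * (1 / 2)) =ᶠ[𝓝 0]
      fun p => p.2 := by
    filter_upwards [dv_quadratic hs hT₂] with p hp
    rw [hp, dv_const]; ring
  have hu := du_eventuallyEq_vec3 hf hx hy
  have hψ := psi_eventuallyEq_vec3 hf hx hy hc hxv (dv_quadratic hσ hT₃)
  have ha0 := (quadratic_jet hS hT₂).1
  obtain ⟨hb0, hbu, hbuu, hbuv⟩ := quadratic_jet hσ' hT₃
  have d1 : DifferentiableAt ℝ (fun p : ℝ × ℝ => p.1 * γ p) 0 :=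
    differentiableAt_fst.fun_mul hγ.differentiableAt
  have d2 : DifferentiableAt ℝ (fun p : ℝ × ℝ => p.2 * δ p) 0 :=
    differentiableAt_snd.fun_mul hδ.differentiableAt
  have hTu : du (fun p : ℝ × ℝ => p.1 * γ p + p.2 * δ p) 0 = γ 0 := by
    rw [du_add d1 d2, du_fst_mul_zero hγ.differentiableAt, du_snd_mul_zero hδ.differentiableAt,
      add_zero]
  have hTv : dv (fun p : ℝ × ℝ => p.1 * γ p + p.2 * δ p) 0 = δ 0 := by
    rw [dv_add d1 d2, dv_fst_mul_zero hγ.differentiableAt, dv_snd_mul_zero hδ.differentiableAt,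
      zero_add]
  have d3 := hT₃.dv.differentiableAt
  have d4 := differentiableAt_snd.fun_mul d3
  have d5 := hT₃.differentiableAt.const_mul (2 : ℝ)
  have hcu : du (fun p => 2 * (p.1 * γ p + p.2 * δ p) +
      p.2 * dv (fun p : ℝ × ℝ => p.1 * γ p + p.2 * δ p) p) 0 = 2 * γ 0 := by
    rw [du_add d5 d4, du_mul (differentiableAt_const _) hT₃.differentiableAt, du_const, hTu,
      du_snd_mul_zero d3]
    ring
  have hcv : dv (fun p => 2 * (p.1 * γ p + p.2 * δ p) +
      p.2 * dv (fun p : ℝ × ℝ => p.1 * γ p + p.2 * δ p) p) 0 = 3 * δ 0 := by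
    rw [dv_add d5 d4, dv_mul (differentiableAt_const _) hT₃.differentiableAt, dv_const, hTv,
      dv_snd_mul_zero d3, hTv]
    ring
  have hσu : du (fun p : ℝ × ℝ => β + p.1 * τ p.1) 0 = τ 0 := by
    rw [du_add (differentiableAt_const _) (differentiableAt_fst.fun_mul hτ'.differentiableAt),
      du_const, du_fst_mul_zero hτ'.differentiableAt, zero_add]
    rfl
  have hσv : dv (fun p : ℝ × ℝ => β + p.1 * τ p.1) 0 = 0 :=
    dv_comp_fst (s := fun u => β + u * τ u) (p := 0) hσ.differentiableAt
  have hcv0 := hcv.trans_ne (mul_ne_zero three_ne_zero hδ0)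
  have hc0 : (fun p : ℝ × ℝ => 2 * (p.1 * γ p + p.2 * δ p) +
      p.2 * dv (fun p : ℝ × ℝ => p.1 * γ p + p.2 * δ p) p) 0 = 0 := by simp
  refine ⟨normal_zero hu hψ hb0 hc0, ?_, ?_⟩
  · rw [principalCurvature_zero hu hψ hx.du hy.du hc ha0 hb0 hc0 hcv0, hbu]
    simp
  -- The mixed term vanishes because `β + u τ` depends on `u` alone; what remains is `9 δ² · 6 τ + 8
  -- γ³ = 2 (27 τ δ² + 4 γ³)`.
  · rw [isRidgePoint_iff hu hψ hx.du hy.du hc ha0 hb0 hc0 hcv0, hcu, hcv, hbuu, hbuv, hσu, hσv]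
    constructor <;> intro h <;> linarith

theorem distanceSquared_eventuallyEq {x y : ℝ × ℝ → ℝ}
    (hf : f =ᶠ[𝓝 0] fun p => !₂[p.1, x p, y p]) (hx0 : x 0 = 0) (hy0 : y 0 = 0)
    (hν : normal f 0 = !₂[0, 0, 1]) :
    distanceSquared f =ᶠ[𝓝 0] fun p =>
      focalRadius f * y p - (p.1 ^ 2 + x p ^ 2 + y p ^ 2) / 2 := by
  have hfoc : focalPoint f = !₂[0, 0, focalRadius f] := by
    rw [focalPoint, hf.self_of_nhds, hν]
    ext i
    fin_cases i <;> simp [hx0, hy0]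
  filter_upwards [hf] with p hp
  rw [distanceSquared, hfoc, hp, EuclideanSpace.norm_sq_eq]
  simp [Fin.sum_univ_three]
  ring

theorem hasD4Singularity_distanceSquared_iff
    (hf : f =ᶠ[𝓝 0] fun p => !₂[p.1, p.1 ^ 2 * s p.1 + p.2 ^ 2 * (1 / 2),
      p.1 ^ 2 * (β + p.1 * τ p.1) + p.2 ^ 2 * (p.1 * γ p + p.2 * δ p)])
    (hs : SmoothGerm s 0) (hτ : SmoothGerm τ 0) (hγ : SmoothGerm γ 0) (hδ : SmoothGerm δ 0)
    (hδ0 : δ 0 ≠ 0) (hκ : principalCurvature f 0 ≠ 0) :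
    HasD4Singularity (distanceSquared f) ↔ τ 0 ≠ 0 ∧ ¬ IsRidgePoint f := by
  obtain ⟨hν, hk0, hridge⟩ := cuspidalEdge_invariants hf hs hτ hγ hδ hδ0
  have hφ := distanceSquared_eventuallyEq hf (by simp) (by simp) hν
  set t := focalRadius f with ht
  have ht0 : t ≠ 0 := one_div_ne_zero hκ
  have htβ : t * (2 * β) = 1 := by
    rw [ht, focalRadius, ← hk0]; exact one_div_mul_cancel hκ
  have hs' : SmoothGerm (fun p : ℝ × ℝ => s p.1) 0 := hs.comp_fst
  have hτ' : SmoothGerm (fun p : ℝ × ℝ => τ p.1) 0 := hτ.comp_fst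
  have hσ : SmoothGerm (fun p : ℝ × ℝ => β + p.1 * τ p.1) 0 :=
    (smoothGerm_const β).add (smoothGerm_fst.mul hτ')
  have hT : SmoothGerm (fun p : ℝ × ℝ => p.1 * γ p + p.2 * δ p) 0 :=
    (smoothGerm_fst.mul hγ).add (smoothGerm_snd.mul hδ)
  have hy : SmoothGerm (fun p : ℝ × ℝ =>
      p.1 ^ 2 * (β + p.1 * τ p.1) + p.2 ^ 2 * (p.1 * γ p + p.2 * δ p)) 0 :=
    ((smoothGerm_fst.pow 2).mul hσ).add ((smoothGerm_snd.pow 2).mul hT)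
  have ct : ∀ r : ℝ, SmoothGerm (fun _ : ℝ × ℝ => r) 0 := fun r => smoothGerm_const r
  -- The coefficients `A`, `B`, `C`, `D` distribute `t y - (u² + x² + y²)/2` over the cubic
  -- monomials. The pieces coming from `x²` and `y²` vanish at the origin; `htβ` cancels the `u²`
  -- terms.
  have hA : SmoothGerm (fun p : ℝ × ℝ => t * τ p.1
      - (1 / 2) * (p.1 * (s p.1 ^ 2 + (β + p.1 * τ p.1) ^ 2))) 0 :=
    ((ct t).mul hτ').sub ((ct _).mul (smoothGerm_fst.mul ((hs'.pow 2).add (hσ.pow 2))))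
  have hB : SmoothGerm (fun p : ℝ × ℝ =>
      -((1 / 2) * (p.2 * ((β + p.1 * τ p.1) * (p.1 * γ p + p.2 * δ p))))) 0 :=
    ((ct _).mul (smoothGerm_snd.mul (hσ.mul hT))).neg
  have hC : SmoothGerm (fun p : ℝ × ℝ => t * γ p - (1 / 2) * (p.1 * s p.1 + γ p *
      (p.1 ^ 2 * (β + p.1 * τ p.1) + p.2 ^ 2 * (p.1 * γ p + p.2 * δ p)))) 0 :=
    ((ct t).mul hγ).sub ((ct _).mul ((smoothGerm_fst.mul hs').add (hγ.mul hy)))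
  have hD : SmoothGerm (fun p : ℝ × ℝ => t * δ p - (1 / 2) * ((1 / 4) * p.2 + δ p *
      (p.1 ^ 2 * (β + p.1 * τ p.1) + p.2 ^ 2 * (p.1 * γ p + p.2 * δ p)))) 0 :=
    ((ct t).mul hδ).sub ((ct _).mul (((ct _).mul smoothGerm_snd).add (hδ.mul hy)))
  rw [hasD4Singularity_iff hA hB hC hD ?_ ?_, hridge]
  · have hdisc : cubicDisc (t * τ 0) 0 (t * γ 0) (t * δ 0) =
        -t ^ 4 * (τ 0 * (27 * τ 0 * δ 0 ^ 2 + 4 * γ 0 ^ 3)) := by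
      rw [cubicDisc]; ring
    simp only [Prod.fst_zero, Prod.snd_zero, zero_mul, mul_zero, zero_pow two_ne_zero, add_zero,
      sub_zero, neg_zero, hdisc, ne_eq, mul_eq_zero, neg_eq_zero, pow_eq_zero_iff four_ne_zero,
      ht0, false_or, not_or]
  · filter_upwards [hφ] with p hp
    rw [hp]
    linear_combination (p.1 ^ 2 / 2) * htβ
  · simpa using ⟨ht0, hδ0⟩

end DistanceSquared

end CuspidalEdge

end

theorem theorem3p3 (a₂₀ a₃₀ b₂₀ b₃₀ b₁₂ b₀₃ : ℝ) (h₁ h₂ h₃ h₄ : ℝ → ℝ) (h₅ : ℝ × ℝ → ℝ)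
    (hh₁ : SmoothGerm h₁ 0) (hh₂ : SmoothGerm h₂ 0) (hh₃ : SmoothGerm h₃ 0)
    (hh₄ : SmoothGerm h₄ 0) (hh₅ : SmoothGerm h₅ 0)
    (hb₂₀ : 0 ≤ b₂₀) (hb₀₃ : b₀₃ ≠ 0)
    (f : ℝ × ℝ → E3)
    (hf : f =ᶠ[𝓝 0] normalForm a₂₀ a₃₀ b₂₀ b₃₀ b₁₂ b₀₃ h₁ h₂ h₃ h₄ h₅)
    (hκ : principalCurvature f 0 ≠ 0) :
    HasD4Singularity (distanceSquared f) ↔ b₃₀ ≠ 0 ∧ ¬ IsRidgePoint f := by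
  have hid : SmoothGerm (fun u : ℝ => u) 0 := smoothGerm_of_contDiff contDiff_id
  have hs : SmoothGerm (fun u => a₂₀ / 2 + (u * (a₃₀ / 6) + u ^ 2 * h₁ u)) 0 :=
    (smoothGerm_const _).add ((hid.mul (smoothGerm_const _)).add ((hid.pow 2).mul hh₁))
  have hτ : SmoothGerm (fun u => b₃₀ / 6 + u * h₂ u) 0 :=
    (smoothGerm_const _).add (hid.mul hh₂)
  have hγ : SmoothGerm (fun p : ℝ × ℝ => b₁₂ / 2 + (p.1 * h₃ p.1 + p.2 * h₄ p.1)) 0 :=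
    (smoothGerm_const _).add ((smoothGerm_fst.mul hh₃.comp_fst).add
      (smoothGerm_snd.mul hh₄.comp_fst))
  have hδ : SmoothGerm (fun p : ℝ × ℝ => b₀₃ / 6 + p.2 * h₅ p) 0 :=
    (smoothGerm_const _).add (smoothGerm_snd.mul hh₅)
  -- Regrouping by `u²` and `v²` gives `τ 0 = b₃₀ / 6` and `δ 0 = b₀₃ / 6`, so `τ 0 ≠ 0` is the
  -- condition on `b₃₀`.
  have hf' : f =ᶠ[𝓝 0] fun p => !₂[p.1,
      p.1 ^ 2 * (fun u => a₂₀ / 2 + (u * (a₃₀ / 6) + u ^ 2 * h₁ u)) p.1 + p.2 ^ 2 * (1 / 2),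
      p.1 ^ 2 * (b₂₀ / 2 + p.1 * (fun u => b₃₀ / 6 + u * h₂ u) p.1) +
        p.2 ^ 2 * (p.1 * (fun p : ℝ × ℝ => b₁₂ / 2 + (p.1 * h₃ p.1 + p.2 * h₄ p.1)) p
          + p.2 * (fun p : ℝ × ℝ => b₀₃ / 6 + p.2 * h₅ p) p)] := by
    refine hf.trans (Filter.Eventually.of_forall ?_)
    rintro ⟨u, v⟩
    simp only [normalForm]
    ext i
    fin_cases i <;> simp <;> ring
  rw [hasD4Singularity_distanceSquared_iff hf' hs hτ hγ hδ (by simpa using hb₀₃) hκ]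
  simp
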